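/- Let $\Omega\subset\mathbb R^2$ be a bounded domain with Lipschitz boundary $\Gamma$, let $\mathbf n$ be the outward unit normal (defined almost everywhere on $\Gamma$ with respect to arc length $ds$), and let $\mathbf c:\overline\Omega\to\mathbb R^2$ be a Lipschitz continuous velocity field. Put $$\Gamma_i=\{\zeta\in\Gamma:\ \mathbf c^\top\mathbf n<0\},\qquad \Gamma_o=\{\zeta\in\Gamma:\ \mathbf c^\top\mathbf n>0\}.$$ Let $\Phi=(\phi_1,\dots,\phi_N)^\top$ with $\phi_1,\dots,\phi_N\in H^1(\Omega)$, and let $x_d:[0,\infty)\to\mathbb R^N$ be a differentiable solution of the Galerkin approximation of the transport equation $\partial_t x+\operatorname{div}(\mathbf c\,x)=0$, that is, with $x^{ap}(\zeta,t)=\Phi(\zeta)^\top x_d(t)$, $$\iint_\Omega \Phi\,\bigl[\Phi^\top\dot x_d(t)+\operatorname{div}(\mathbf c\,\Phi^\top x_d(t))\bigr]\,d\zeta=0\qquad (t\ge 0),$$ where divergences are taken in the weak sense. Let the input $u$ and the output $y$ be the boundary values (traces) of $x^{ap}$: $u(\cdot,t)=x^{ap}(\cdot,t)$ on $\Gamma_i$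 and $y(\cdot,t)=x^{ap}(\cdot,t)$ on $\Gamma_o$. Let $$H_d(t)=\tfrac12\iint_\Omega x^{ap}(\zeta,t)^2\,d\zeta .$$ Then all the integrals below exist, and for every $t\ge 0$ (one-sided derivative at $t=0$): 1. $H_d(t)=\tfrac12\,x_d(t)^\top M x_d(t)$ with $M=\iint_\Omega\Phi\Phi^\top d\zeta$; 2. $\displaystyle \dot H_d(t)=-\tfrac12\iint_\Omega (x^{ap})^2\operatorname{div}(\mathbf c)\,d\zeta-\tfrac12\int_\Gamma (x^{ap})^2\,\mathbf c^\top\mathbf n\,ds$; 3. $\displaystyle \dot H_d(t)=-\tfrac12\,x_d(t)^\top\Bigl(\iint_\Omega\Phi\operatorname{div}(\mathbf c)\Phi^\top d\zeta\Bigr)x_d(t)+\tfrac12\int_{\Gamma_i}u^2\,|\mathbf c^\top\mathbf n|\,ds-\tfrac12\int_{\Gamma_o}y^2\,\mathbf c^\top\mathbf n\,ds$; 4. if $\operatorname{div}(\mathbf c)=0$ almost everywhere in $\Omega$, the scattering energy preserving balance holds exactly: $$\dot H_d(t)=\tfrac12\int_{\Gamma_i}u^2\,|\mathbf c^\top\mathbf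 n|\,ds-\tfrac12\int_{\Gamma_o}y^2\,\mathbf c^\top\mathbf n\,ds .$$ -/

import Mathlib

open MeasureTheory Set Filter Topology
open scoped ContDiff ENNReal

noncomputable section

namespace Transport2D

/-- The Euclidean plane. -/
abbrev Plane : Type := EuclideanSpace ℝ (Fin 2)

/-- A bounded open set with Lipschitz boundary: near every boundary point, and in suitable
Cartesian coordinates, the set is the strict epigraph of a Lipschitz function. -/
structure IsBoundedLipschitz (Ω : Set Plane) : Prop where
  isOpen : IsOpen Ω
  isBounded : Bornology.IsBounded Ω
  boundary : ∀ z ∈ frontier Ω, ∃ (e : Plane ≃ᵃⁱ[ℝ] Plane) (f : ℝ → ℝ) (K : NNReal),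
    LipschitzWith K f ∧ ∀ᶠ p in 𝓝 z, (p ∈ Ω ↔ f (e p 0) < e p 1)

/-- Arc length on the boundary `Γ` of `Ω`: the one-dimensional Hausdorff measure. -/
def boundaryMeasure (Ω : Set Plane) : Measure Plane :=
  (Measure.hausdorffMeasure 1).restrict (frontier Ω)

/-- `n` is the outward unit normal of `Ω` at `z`: up to arbitrarily thin cones around the line
orthogonal to `n`, the set `Ω` is, near `z`, the half-plane on the side of `-n`.
There is at most one such `n`. -/
def IsOuterNormal (Ω : Set Plane) (z n : Plane) : Prop :=
  ‖n‖ = 1 ∧ ∀ ε : ℝ, 0 < ε → ∀ᶠ p in 𝓝 z,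
    (inner ℝ (p - z) n < -(ε * ‖p - z‖) → p ∈ Ω) ∧
    (ε * ‖p - z‖ < inner ℝ (p - z) n → p ∉ Ω)

open Classical in
/-- The outward unit normal field (`0` at the boundary points without a normal, e.g. corners). -/
def outerNormal (Ω : Set Plane) (z : Plane) : Plane :=
  if h : ∃ n, IsOuterNormal Ω z n then h.choose else 0

/-- Smooth functions with compact support in `Ω`. -/
def IsTest (Ω : Set Plane) (ψ : Plane → ℝ) : Prop :=
  ContDiff ℝ ∞ ψ ∧ HasCompactSupport ψ ∧ tsupport ψ ⊆ Ω

/-- `G` is the weak gradient of `φ` in `Ω`. -/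
def IsWeakGrad (Ω : Set Plane) (φ : Plane → ℝ) (G : Plane → Plane) : Prop :=
  LocallyIntegrableOn φ Ω ∧ LocallyIntegrableOn G Ω ∧
  ∀ ψ, IsTest Ω ψ → ∀ v : Plane,
    ∫ z in Ω, φ z * fderiv ℝ ψ z v = -∫ z in Ω, inner ℝ (G z) v * ψ z

/-- `d` is the weak divergence of the vector field `w` in `Ω`. -/
def IsWeakDiv (Ω : Set Plane) (w : Plane → Plane) (d : Plane → ℝ) : Prop :=
  LocallyIntegrableOn w Ω ∧ LocallyIntegrableOn d Ω ∧
  ∀ ψ, IsTest Ω ψ → ∫ z in Ω, fderiv ℝ ψ z (w z) = -∫ z in Ω, d z * ψ z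

open Classical in
/-- The divergence of `w` in `Ω`, in the weak sense (determined almost everywhere in `Ω`). -/
def weakDiv (Ω : Set Plane) (w : Plane → Plane) : Plane → ℝ :=
  if h : ∃ d, IsWeakDiv Ω w d then h.choose else 0

/-- The Sobolev space `H¹(Ω)`. -/
def MemH1 (Ω : Set Plane) (φ : Plane → ℝ) : Prop :=
  MemLp φ 2 (volume.restrict Ω) ∧
  ∃ G : Plane → Plane, IsWeakGrad Ω φ G ∧ MemLp G 2 (volume.restrict Ω)

/-- `g ∈ L²(Γ)` is the trace of `φ` on the boundary: the value at `φ` of the continuous extension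
to `H¹(Ω)` of the restriction map `ψ ↦ ψ|_Γ` on functions that are smooth up to the boundary. -/
def IsTrace (Ω : Set Plane) (φ g : Plane → ℝ) : Prop :=
  MemLp g 2 (boundaryMeasure Ω) ∧
  ∃ (G : Plane → Plane) (ψ : ℕ → Plane → ℝ), IsWeakGrad Ω φ G ∧ (∀ k, ContDiff ℝ ∞ (ψ k)) ∧
    Tendsto (fun k => eLpNorm (fun z => ψ k z - φ z) 2 (volume.restrict Ω)) atTop (𝓝 0) ∧
    Tendsto (fun k => eLpNorm (fun z => gradient (ψ k) z - G z) 2 (volume.restrict Ω))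
      atTop (𝓝 0) ∧
    Tendsto (fun k => eLpNorm (fun z => ψ k z - g z) 2 (boundaryMeasure Ω)) atTop (𝓝 0)

open Classical in
/-- The trace of `φ` on the boundary of `Ω` (determined almost everywhere on the boundary). -/
def boundaryTrace (Ω : Set Plane) (φ : Plane → ℝ) : Plane → ℝ :=
  if h : ∃ g, IsTrace Ω φ g then h.choose else 0

/-- The normal component `cᵀn` of the velocity on the boundary. -/
def normalFlux (Ω : Set Plane) (c : Plane → Plane) (z : Plane) : ℝ :=
  inner ℝ (c z) (outerNormal Ω z)

/-- The input boundary `Γ_i`. -/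
def inflow (Ω : Set Plane) (c : Plane → Plane) : Set Plane :=
  {z ∈ frontier Ω | normalFlux Ω c z < 0}

/-- The output boundary `Γ_o`. -/
def outflow (Ω : Set Plane) (c : Plane → Plane) : Set Plane :=
  {z ∈ frontier Ω | 0 < normalFlux Ω c z}

variable {N : ℕ}

/-- The approximation `x^{ap} = Φᵀ x_d`. -/
def approx (Φ : Fin N → Plane → ℝ) (a : Fin N → ℝ) (z : Plane) : ℝ :=
  ∑ j, Φ j z * a j

/-- The mass matrix `M = ∬ Φ Φᵀ`. -/
def massMatrix (Ω : Set Plane) (Φ : Fin N → Plane → ℝ) : Matrix (Fin N) (Fin N) ℝ :=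
  Matrix.of fun i j => ∫ z in Ω, Φ i z * Φ j z

/-- The matrix `∬ Φ div(c) Φᵀ`. -/
def divMatrix (Ω : Set Plane) (c : Plane → Plane) (Φ : Fin N → Plane → ℝ) :
    Matrix (Fin N) (Fin N) ℝ :=
  Matrix.of fun i j => ∫ z in Ω, Φ i z * weakDiv Ω c z * Φ j z

/-- The discretized Hamiltonian: `½ ∬ x²` evaluated at `x = x^{ap}`. -/
def discreteHamiltonian (Ω : Set Plane) (Φ : Fin N → Plane → ℝ) (a : Fin N → ℝ) : ℝ :=
  1 / 2 * ∫ z in Ω, approx Φ a z * approx Φ a z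

/-- `x_d` is, for `t ≥ 0`, a differentiable solution of the Galerkin system
`∬ Φ [Φᵀ ẋ_d + div(c Φᵀ x_d)] = 0`. -/
def IsGalerkinSolution (Ω : Set Plane) (c : Plane → Plane) (Φ : Fin N → Plane → ℝ)
    (xd : ℝ → Fin N → ℝ) : Prop :=
  ∀ t : ℝ, 0 ≤ t → ∃ v : Fin N → ℝ, HasDerivWithinAt xd v (Ici 0) t ∧
    ∀ i, ∫ z in Ω, Φ i z *
      (approx Φ v z + weakDiv Ω (fun p => approx Φ (xd t) p • c p) z) = 0

end Transport2D

end

/-!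
Testing the Galerkin equations with `x_d` itself makes `Ḣ_d` equal to `-∬ x div(c x)` with
`x = x^{ap}`, so that everything rests on Green's identity
`2 ∬ x div(c x) = ∬ x² div(c) + ∫_Γ x² cᵀn` for `x ∈ H¹(Ω)`.

For Lipschitz functions the divergence theorem is local. Under an epigraph `f (e p 0) < e p 1` the
shear that flattens the graph reduces it to the one-dimensional fundamental theorem of calculus,
and the area formula for the Lipschitz curve `s ↦ (s, f s)` identifies the boundary term with an
integral against arc length; by Rademacher's theorem the graph has a tangent, hence `Ω` a normal,
almost everywhere.

The passage to `H¹(Ω)` is by density of the functions that are smooth up to the boundary. Near a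
boundary point `Ω` contains a translated cone at each of its points, so that mollifying with bump
functions supported in this cone only samples the function inside `Ω`. The divergence theorem,
applied to `ψ² V` with a vector field `V` that is transversal to `Γ`, bounds the `L²(Γ)` norm of
`ψ` by its `H¹(Ω)` norm, so that boundary values converge along with the approximations.
-/

noncomputable section

namespace Transport2D

open scoped NNReal

section AreaFormula

open scoped Measure

variable {E : Type*} [NormedAddCommGroup E] [NormedSpace ℝ E] {γ : ℝ → E} {L : ℝ →L[ℝ] E}
  {A : Set ℝ} {ε : ℝ≥0}

lemma abs_dist_sub_le_of_approximatesLinearOn (h : ApproximatesLinearOn γ L A ε) {s t : ℝ}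
    (hs : s ∈ A) (ht : t ∈ A) : |dist (γ s) (γ t) - ‖L 1‖ * dist s t| ≤ ε * dist s t := by
  have hL : ‖L (s - t)‖ = ‖L 1‖ * dist s t := by
    rw [← mul_one (s - t), ← smul_eq_mul, map_smul, norm_smul, mul_comm, dist_eq_norm]
  rw [← hL, dist_eq_norm, dist_eq_norm]
  exact (abs_norm_sub_norm_le _ _).trans (h s hs t ht)

lemma norm_deriv_sub_le_of_approximatesLinearOn (h : ApproximatesLinearOn γ L A ε) {s : ℝ}
    (hs : s ∈ A) (hacc : AccPt s (𝓟 A)) (hd : DifferentiableAt ℝ γ s) :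
    ‖deriv γ s - L 1‖ ≤ ε := by
  have : (𝓝[≠] s ⊓ 𝓟 A).NeBot := hacc
  have hslope : Tendsto (slope γ s) (𝓝[≠] s ⊓ 𝓟 A) (𝓝 (deriv γ s)) :=
    (hasDerivAt_iff_tendsto_slope.1 hd.hasDerivAt).mono_left inf_le_left
  refine le_of_tendsto (hslope.sub_const (L 1)).norm ?_
  filter_upwards [mem_inf_of_left self_mem_nhdsWithin, mem_inf_of_right (mem_principal_self A)]
    with t hts htA
  have hts0 : t - s ≠ 0 := sub_ne_zero.2 hts
  have hL : L 1 = (t - s)⁻¹ • L (t - s) := by rw [← map_smul, smul_eq_mul, inv_mul_cancel₀ hts0]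
  rw [slope_def_module, hL, ← smul_sub, norm_smul, norm_inv,
    inv_mul_le_iff₀ (norm_pos_iff.2 hts0), mul_comm]
  exact h t htA s hs

lemma ae_accPt (A : Set ℝ) : ∀ᵐ s, s ∈ A → AccPt s (𝓟 A) := by
  filter_upwards [(countable_setOfPred_isolated_right_within (s := A)).ae_notMem volume]
    with s hs hsA
  have hright : (𝓝[A ∩ Ioi s] s).NeBot := neBot_iff.2 fun hbot => hs ⟨hsA, hbot⟩
  exact accPt_principal_iff_nhdsWithin.2
    (hright.mono (nhdsWithin_mono s fun t ht => ⟨ht.1, ne_of_gt ht.2⟩))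

lemma ae_enorm_deriv_le_of_approximatesLinearOn (h : ApproximatesLinearOn γ L A ε)
    (hd : ∀ s ∈ A, DifferentiableAt ℝ γ s) :
    ∀ᵐ s, s ∈ A → ‖deriv γ s‖ₑ ≤ ‖L 1‖ₑ + ε ∧ ‖L 1‖ₑ ≤ ‖deriv γ s‖ₑ + ε := by
  filter_upwards [ae_accPt A] with s hacc hs
  have hle : ‖deriv γ s - L 1‖ₑ ≤ ε := by
    exact_mod_cast norm_deriv_sub_le_of_approximatesLinearOn h hs (hacc hs) (hd s hs)
  constructor
  · calc ‖deriv γ s‖ₑ = ‖L 1 + (deriv γ s - L 1)‖ₑ := by rw [add_sub_cancel]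
      _ ≤ ‖L 1‖ₑ + ε := (enorm_add_le _ _).trans (by gcongr)
  · calc ‖L 1‖ₑ = ‖deriv γ s - (deriv γ s - L 1)‖ₑ := by rw [sub_sub_cancel]
      _ ≤ ‖deriv γ s‖ₑ + ε := enorm_sub_le.trans (by gcongr)

variable [MeasurableSpace E] [BorelSpace E]

lemma hausdorffMeasure_image_le_of_approximatesLinearOn (h : ApproximatesLinearOn γ L A ε) :
    μH[1] (γ '' A) ≤ (‖L 1‖ₑ + ε) * volume A := by
  have hlip : LipschitzOnWith (‖L 1‖₊ + ε) γ A := LipschitzOnWith.of_dist_le_mul fun s hs t ht => by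
    have := (abs_le.1 (abs_dist_sub_le_of_approximatesLinearOn h hs ht)).2
    rw [NNReal.coe_add, coe_nnnorm, add_mul]
    linarith
  simpa [hausdorffMeasure_real, enorm] using hlip.hausdorffMeasure_image_le (d := 1) zero_le_one

lemma mul_volume_le_hausdorffMeasure_image_add (h : ApproximatesLinearOn γ L A ε) :
    ‖L 1‖ₑ * volume A ≤ μH[1] (γ '' A) + ε * volume A := by
  rcases le_or_gt ‖L 1‖₊ ε with hle | hlt
  · exact le_add_left (mul_le_mul_left (ENNReal.coe_le_coe.2 hle) _)
  have hpos : 0 < ‖L 1‖₊ - ε := tsub_pos_of_lt hlt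
  have hanti : AntilipschitzWith (‖L 1‖₊ - ε)⁻¹ (A.domRestrict γ) :=
    AntilipschitzWith.of_le_mul_dist fun s t => by
      have hle := (abs_le.1 (abs_dist_sub_le_of_approximatesLinearOn h s.2 t.2)).1
      rw [NNReal.coe_inv, ← div_eq_inv_mul, le_div_iff₀ (NNReal.coe_pos.2 hpos),
        NNReal.coe_sub hlt.le, mul_sub]
      simp only [domRestrict_apply, coe_nnnorm, Subtype.dist_eq]
      linarith
  have hsub : μH[1] (univ : Set A) = volume A := by
    have := (isometry_subtype_coe (s := A)).hausdorffMeasure_image (Or.inl zero_le_one) univ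
    rw [← this, image_univ, Subtype.range_coe, hausdorffMeasure_real]
  have hvol : volume A ≤ (‖L 1‖₊ - ε : ℝ≥0)⁻¹ * μH[1] (γ '' A) := by
    simpa [hsub, range_domRestrict] using hanti.le_hausdorffMeasure_image (d := 1) zero_le_one univ
  calc ‖L 1‖ₑ * volume A = (‖L 1‖₊ - ε : ℝ≥0) * volume A + ε * volume A := by
        rw [← add_mul, ← ENNReal.coe_add, tsub_add_cancel_of_le hlt.le]; rfl
    _ ≤ μH[1] (γ '' A) + ε * volume A := by
        gcongr
        rwa [ENNReal.coe_inv hpos.ne', ← ENNReal.div_eq_inv_mul,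
          ENNReal.le_div_iff_mul_le (Or.inl (ENNReal.coe_ne_zero.2 hpos.ne'))
            (Or.inl ENNReal.coe_ne_top), mul_comm] at hvol

lemma hausdorffMeasure_image_le_lintegral_add (h : ApproximatesLinearOn γ L A ε)
    (hA : MeasurableSet A) (hd : ∀ s ∈ A, DifferentiableAt ℝ γ s) :
    μH[1] (γ '' A) ≤ (∫⁻ s in A, ‖deriv γ s‖ₑ) + 2 * ε * volume A :=
  calc μH[1] (γ '' A) ≤ (‖L 1‖ₑ + ε) * volume A :=
        hausdorffMeasure_image_le_of_approximatesLinearOn h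
    _ = ∫⁻ _ in A, (‖L 1‖ₑ + ε) := (setLIntegral_const A _).symm
    _ ≤ ∫⁻ s in A, (‖deriv γ s‖ₑ + 2 * ε) := by
        refine setLIntegral_mono_ae' hA ?_
        filter_upwards [ae_enorm_deriv_le_of_approximatesLinearOn h hd] with s hs hsA
        rw [two_mul, ← add_assoc]
        gcongr
        exact (hs hsA).2
    _ = (∫⁻ s in A, ‖deriv γ s‖ₑ) + 2 * ε * volume A := by
        rw [lintegral_add_right _ measurable_const, setLIntegral_const]

lemma lintegral_le_hausdorffMeasure_image_add (h : ApproximatesLinearOn γ L A ε)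
    (hA : MeasurableSet A) (hd : ∀ s ∈ A, DifferentiableAt ℝ γ s) :
    ∫⁻ s in A, ‖deriv γ s‖ₑ ≤ μH[1] (γ '' A) + 2 * ε * volume A :=
  calc ∫⁻ s in A, ‖deriv γ s‖ₑ ≤ ∫⁻ _ in A, (‖L 1‖ₑ + ε) := by
        refine setLIntegral_mono_ae' hA ?_
        filter_upwards [ae_enorm_deriv_le_of_approximatesLinearOn h hd] with s hs hsA
          using (hs hsA).1
    _ = ‖L 1‖ₑ * volume A + ε * volume A := by rw [setLIntegral_const, add_mul]
    _ ≤ μH[1] (γ '' A) + ε * volume A + ε * volume A := by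
        gcongr
        exact mul_volume_le_hausdorffMeasure_image_add h
    _ = μH[1] (γ '' A) + 2 * ε * volume A := by rw [add_assoc, ← add_mul, two_mul]

variable [FiniteDimensional ℝ E]

/- Partition `A` into countably many pieces on which `γ` is linear up to `ε`; the errors add up to
`2 ε |A|`. -/
lemma hausdorffMeasure_image_lintegral_le (hinj : γ.Injective) (hγ : Continuous γ)
    (hA : MeasurableSet A) (hd : ∀ s ∈ A, DifferentiableAt ℝ γ s) (hε : ε ≠ 0) :
    μH[1] (γ '' A) ≤ (∫⁻ s in A, ‖deriv γ s‖ₑ) + 2 * ε * volume A ∧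
      ∫⁻ s in A, ‖deriv γ s‖ₑ ≤ μH[1] (γ '' A) + 2 * ε * volume A := by
  obtain ⟨t, L, tdisj, tmeas, tcov, happrox, -⟩ :=
    exists_partition_approximatesLinearOn_of_hasFDerivWithinAt γ A (fderiv ℝ γ)
      (fun s hs => (hd s hs).hasFDerivAt.hasFDerivWithinAt) (fun _ => ε) (fun _ => hε)
  have hmeas n : MeasurableSet (A ∩ t n) := hA.inter (tmeas n)
  have hdisj : Pairwise (Function.onFun Disjoint fun n => A ∩ t n) :=
    pairwise_disjoint_mono tdisj fun n => inter_subset_right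
  have hunion : ⋃ n, A ∩ t n = A := by rw [← inter_iUnion, inter_eq_self_of_subset_left tcov]
  have hdn n : ∀ s ∈ A ∩ t n, DifferentiableAt ℝ γ s := fun s hs => hd s hs.1
  have hH : μH[1] (γ '' A) = ∑' n, μH[1] (γ '' (A ∩ t n)) := by
    conv_lhs => rw [← hunion, image_iUnion]
    exact measure_iUnion (fun i j hij => (disjoint_image_iff hinj).2 (hdisj hij))
      fun n => (hγ.measurableEmbedding hinj).measurableSet_image.2 (hmeas n)
  have hI : ∫⁻ s in A, ‖deriv γ s‖ₑ = ∑' n, ∫⁻ s in A ∩ t n, ‖deriv γ s‖ₑ := by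
    conv_lhs => rw [← hunion, lintegral_iUnion hmeas hdisj]
  have hV : 2 * ε * volume A = ∑' n, 2 * ε * volume (A ∩ t n) := by
    rw [ENNReal.tsum_mul_left, ← measure_iUnion hdisj hmeas, hunion]
  rw [hH, hI, hV, ← ENNReal.tsum_add, ← ENNReal.tsum_add]
  exact ⟨ENNReal.tsum_le_tsum fun n =>
      hausdorffMeasure_image_le_lintegral_add (happrox n) (hmeas n) (hdn n),
    ENNReal.tsum_le_tsum fun n =>
      lintegral_le_hausdorffMeasure_image_add (happrox n) (hmeas n) (hdn n)⟩

lemma hausdorffMeasure_image_of_differentiable (hinj : γ.Injective) (hγ : Continuous γ)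
    (hA : MeasurableSet A) (hfin : volume A ≠ ⊤) (hd : ∀ s ∈ A, DifferentiableAt ℝ γ s) :
    μH[1] (γ '' A) = ∫⁻ s in A, ‖deriv γ s‖ₑ := by
  have hlim (c : ℝ≥0∞) : Tendsto (fun ε : ℝ≥0 => c + 2 * ε * volume A) (𝓝[≠] 0) (𝓝 c) := by
    have h0 : Tendsto (fun ε : ℝ≥0 => (ε : ℝ≥0∞)) (𝓝[≠] 0) (𝓝 0) :=
      (ENNReal.tendsto_coe.2 tendsto_id).mono_left nhdsWithin_le_nhds
    simpa using tendsto_const_nhds.add (ENNReal.Tendsto.mul_const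
      (ENNReal.Tendsto.const_mul (a := 2) h0 (Or.inr (by simp))) (Or.inr hfin))
  have hle : ∀ᶠ ε : ℝ≥0 in 𝓝[≠] 0,
      μH[1] (γ '' A) ≤ (∫⁻ s in A, ‖deriv γ s‖ₑ) + 2 * ε * volume A ∧
        ∫⁻ s in A, ‖deriv γ s‖ₑ ≤ μH[1] (γ '' A) + 2 * ε * volume A :=
    eventually_nhdsWithin_of_forall fun ε hε => hausdorffMeasure_image_lintegral_le hinj hγ hA hd hε
  exact le_antisymm (ge_of_tendsto (hlim _) (hle.mono fun _ h => h.1))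
    (ge_of_tendsto (hlim _) (hle.mono fun _ h => h.2))

theorem hausdorffMeasure_image_eq_lintegral {K : ℝ≥0} (hinj : γ.Injective)
    (hγ : LipschitzWith K γ) (hA : MeasurableSet A) (hfin : volume A ≠ ⊤) :
    μH[1] (γ '' A) = ∫⁻ s in A, ‖deriv γ s‖ₑ := by
  set D : Set ℝ := {s | DifferentiableAt ℝ γ s}
  have hD : volume Dᶜ = 0 := hγ.ae_differentiableAt_real
  have hnull : μH[1] (γ '' (A \ D)) = 0 := by
    have := hγ.hausdorffMeasure_image_le (d := 1) zero_le_one (A \ D)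
    rwa [hausdorffMeasure_real, measure_mono_null (fun s hs => hs.2) hD, mul_zero,
      nonpos_iff_eq_zero] at this
  calc μH[1] (γ '' A) = μH[1] (γ '' (A ∩ D)) := by
        conv_lhs => rw [← inter_union_sdiff A D, image_union]
        exact measure_congr (union_ae_eq_left_of_ae_eq_empty (ae_eq_empty.2 hnull))
    _ = ∫⁻ s in A ∩ D, ‖deriv γ s‖ₑ :=
        hausdorffMeasure_image_of_differentiable hinj hγ.continuous
          (hA.inter (measurableSet_of_differentiableAt ℝ γ))
          (measure_ne_top_of_subset inter_subset_left hfin) fun s hs => hs.2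
    _ = ∫⁻ s in A, ‖deriv γ s‖ₑ :=
        setLIntegral_congr (inter_ae_eq_left_of_ae_eq_univ (ae_eq_univ.2 hD))

theorem hausdorffMeasure_restrict_range {K : ℝ≥0} (hinj : γ.Injective) (hγ : LipschitzWith K γ) :
    (μH[1] : Measure E).restrict (range γ) =
      (volume.withDensity fun s => ‖deriv γ s‖ₑ).map γ := by
  have hemb := hγ.continuous.measurableEmbedding hinj
  suffices h : (μH[1] : Measure E).comap γ = volume.withDensity fun s => ‖deriv γ s‖ₑ by
    rw [← h, hemb.map_comap]
  refine Measure.ext_of_iUnion_eq_univ (iUnion_spanningSets volume) fun n => Measure.ext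
    fun A hA => ?_
  have hAn : MeasurableSet (A ∩ spanningSets volume n) :=
    hA.inter (measurableSet_spanningSets volume n)
  rw [Measure.restrict_apply hA, Measure.restrict_apply hA, hemb.comap_apply,
    withDensity_apply _ hAn]
  exact hausdorffMeasure_image_eq_lintegral hinj hγ hAn
    (measure_ne_top_of_subset inter_subset_right (measure_spanningSets_lt_top volume n).ne)

end AreaFormula

/-- In the open set `U` and in the Cartesian coordinates `e`, the set `Ω` is the strict epigraph
of the Lipschitz function `f`. -/
structure IsChart (Ω U : Set Plane) (e : Plane ≃ᵃⁱ[ℝ] Plane) (f : ℝ → ℝ) (K : ℝ≥0) : Prop where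
  isOpen : IsOpen U
  lipschitz : LipschitzWith K f
  mem_iff : ∀ p ∈ U, (p ∈ Ω ↔ f (e p 0) < e p 1)

/-- The speed of the curve `s ↦ (s, f s)`, that is the density of arc length on the graph of `f`
with respect to the abscissa. -/
def arcDensity (f : ℝ → ℝ) (s : ℝ) : ℝ := √(1 + deriv f s ^ 2)

/-- The boundary curve in a chart. -/
def chartCurve (e : Plane ≃ᵃⁱ[ℝ] Plane) (f : ℝ → ℝ) (s : ℝ) : Plane := e.symm !₂[s, f s]

/-- The outward unit normal in a chart. -/
def chartNormal (e : Plane ≃ᵃⁱ[ℝ] Plane) (f : ℝ → ℝ) (s : ℝ) : Plane :=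
  (arcDensity f s)⁻¹ • e.linearIsometryEquiv.symm !₂[deriv f s, -1]

section ChartCurve

variable (e : Plane ≃ᵃⁱ[ℝ] Plane) {f : ℝ → ℝ} {K : ℝ≥0} {s : ℝ}

variable (f s) in
lemma one_le_arcDensity : 1 ≤ arcDensity f s := by
  rw [arcDensity, Real.one_le_sqrt]
  linarith [sq_nonneg (deriv f s)]

variable (f s) in
lemma arcDensity_pos : 0 < arcDensity f s := zero_lt_one.trans_le (one_le_arcDensity f s)

lemma arcDensity_le (hf : LipschitzWith K f) : arcDensity f s ≤ 1 + K := by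
  have hK : |deriv f s| ≤ K := norm_deriv_le_of_lipschitz hf
  rw [arcDensity, Real.sqrt_le_left (by positivity)]
  nlinarith [sq_abs (deriv f s), abs_nonneg (deriv f s), K.coe_nonneg]

variable (f) in
lemma measurable_arcDensity : Measurable (arcDensity f) :=
  (measurable_const.add ((measurable_deriv f).pow_const 2)).sqrt

lemma apply_chartCurve : e (chartCurve e f s) = !₂[s, f s] := e.apply_symm_apply _

lemma continuous_coord (i : Fin 2) : Continuous fun q : Plane => e q i :=
  (EuclideanSpace.proj i : Plane →L[ℝ] ℝ).continuous.comp e.continuous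

lemma antilipschitzWith_chartCurve (f : ℝ → ℝ) : AntilipschitzWith 1 (chartCurve e f) :=
  AntilipschitzWith.of_le_mul_dist fun s t => by
    rw [chartCurve, chartCurve, e.symm.dist_map, NNReal.coe_one, one_mul, dist_eq_norm,
      dist_eq_norm]
    simpa using PiLp.norm_apply_le (!₂[s, f s] - !₂[t, f t]) 0

lemma lipschitzWith_chartCurve (hf : LipschitzWith K f) :
    LipschitzWith (1 + K) (chartCurve e f) :=
  LipschitzWith.of_dist_le_mul fun s t => by
    have hKf : dist (f s) (f t) ≤ K * dist s t := hf.dist_le_mul s t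
    rw [chartCurve, chartCurve, e.symm.dist_map, EuclideanSpace.dist_eq, Fin.sum_univ_two,
      Real.sqrt_le_left (by positivity)]
    have hsq : dist (f s) (f t) ^ 2 ≤ (K * dist s t) ^ 2 := by gcongr
    have hmul : 0 ≤ K * dist s t ^ 2 := by positivity
    simpa using by nlinarith

lemma isClosedEmbedding_chartCurve (hf : LipschitzWith K f) :
    Topology.IsClosedEmbedding (chartCurve e f) :=
  (antilipschitzWith_chartCurve e f).isClosedEmbedding
    (lipschitzWith_chartCurve e hf).uniformContinuous

lemma hasDerivAt_planeMk {a b : ℝ → ℝ} {a' b' : ℝ} (ha : HasDerivAt a a' s)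
    (hb : HasDerivAt b b' s) : HasDerivAt (fun t => (!₂[a t, b t] : Plane)) !₂[a', b'] s :=
  HasFDerivAt.comp_hasDerivAt (f := fun t => ![a t, b t]) (f' := ![a', b']) s
    (PiLp.hasFDerivAt_toLp 2 _) (hasDerivAt_pi.2 (Fin.forall_fin_two.2 ⟨ha, hb⟩))

lemma norm_deriv_chartCurve (hd : DifferentiableAt ℝ f s) :
    ‖deriv (chartCurve e f) s‖ = arcDensity f s := by
  have hcurve : chartCurve e f =
      fun t => e.linearIsometryEquiv.symm !₂[t, f t] + e.symm 0 := funext fun t => by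
    have := e.symm.map_vadd 0 !₂[t, f t]
    rwa [vadd_eq_add, add_zero] at this
  have hderiv : HasDerivAt (chartCurve e f) (e.linearIsometryEquiv.symm !₂[1, deriv f s]) s :=
    hcurve ▸ ((e.linearIsometryEquiv.symm : Plane →L[ℝ] Plane).hasFDerivAt.comp_hasDerivAt s
      (hasDerivAt_planeMk (hasDerivAt_id s) hd.hasDerivAt)).add_const _
  simp [hderiv.deriv, EuclideanSpace.norm_eq, arcDensity]

variable {e} in
lemma mem_range_chartCurve {p : Plane} : p ∈ range (chartCurve e f) ↔ e p 1 = f (e p 0) := by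
  constructor
  · rintro ⟨s, rfl⟩
    simp [apply_chartCurve]
  · intro h
    refine ⟨e p 0, ?_⟩
    rw [chartCurve, ← h, AffineIsometryEquiv.symm_apply_eq]
    ext i
    fin_cases i <;> rfl

variable (f s) in
lemma norm_chartNormal : ‖chartNormal e f s‖ = 1 := by
  have hsum : ‖(!₂[deriv f s, -1] : Plane)‖ = arcDensity f s := by
    simp [EuclideanSpace.norm_eq, arcDensity, add_comm]
  rw [chartNormal, norm_smul, LinearIsometryEquiv.norm_map, hsum, norm_inv,
    Real.norm_of_nonneg (arcDensity_pos f s).le, inv_mul_cancel₀ (arcDensity_pos f s).ne']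

variable (f s) in
lemma inner_chartNormal (v : Plane) :
    inner ℝ v (chartNormal e f s) = (arcDensity f s)⁻¹ *
      (deriv f s * e.linearIsometryEquiv v 0 - e.linearIsometryEquiv v 1) := by
  rw [chartNormal, real_inner_smul_right, ← LinearIsometryEquiv.inner_map_map e.linearIsometryEquiv,
    LinearIsometryEquiv.apply_symm_apply, PiLp.inner_apply, Fin.sum_univ_two]
  simp [sub_eq_add_neg]

variable (f) in
lemma measurable_chartNormal : Measurable (chartNormal e f) := by
  refine (measurable_arcDensity f).inv.smul
    (e.linearIsometryEquiv.symm.continuous.measurable.comp ?_)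
  exact (WithLp.measurable_toLp 2 _).comp (measurable_pi_iff.2
    (Fin.forall_fin_two.2 ⟨measurable_deriv f, measurable_const⟩))

end ChartCurve

section OuterNormal

lemma tendsto_add_smul_nhdsGT_zero (z v : Plane) :
    Tendsto (fun t : ℝ => z + t • v) (𝓝[>] 0) (𝓝 z) := by
  have hcont : Continuous fun t : ℝ => z + t • v := by fun_prop
  simpa using (hcont.tendsto 0).mono_left (nhdsWithin_le_nhds (s := Ioi 0))

variable {Ω : Set Plane} {z n m : Plane}

/- If `n ≠ m`, moving from `z` in the direction `m - n` one would both enter and leave `Ω`. -/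
lemma IsOuterNormal.unique (hn : IsOuterNormal Ω z n) (hm : IsOuterNormal Ω z m) : n = m := by
  by_contra hne
  set v := m - n with hv
  have hv0 : 0 < ‖v‖ := norm_pos_iff.2 (sub_ne_zero.2 (Ne.symm hne))
  have hvv : ‖v‖ ^ 2 = 2 - 2 * inner ℝ m n := by
    rw [hv, norm_sub_sq_real, hn.1, hm.1]
    ring
  have hvn : inner ℝ v n = -(‖v‖ ^ 2 / 2) := by
    rw [hvv, hv, inner_sub_left, real_inner_self_eq_norm_sq, hn.1]
    ring
  have hvm : inner ℝ v m = ‖v‖ ^ 2 / 2 := by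
    rw [hvv, hv, inner_sub_left, real_inner_self_eq_norm_sq, hm.1, real_inner_comm]
    ring
  have hε : 0 < ‖v‖ / 4 := by positivity
  obtain ⟨t, ⟨⟨hmem, -⟩, ⟨-, hnotMem⟩⟩, ht⟩ :=
    (((tendsto_add_smul_nhdsGT_zero z v).eventually ((hn.2 _ hε).and (hm.2 _ hε))).and
      self_mem_nhdsWithin).exists
  simp only [add_sub_cancel_left, real_inner_smul_left, norm_smul, Real.norm_eq_abs,
    abs_of_pos (show 0 < t from ht), hvn, hvm] at hmem hnotMem
  have htv : 0 < t * ‖v‖ ^ 2 := mul_pos ht (by positivity)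
  exact hnotMem (by nlinarith) (hmem (by nlinarith))

lemma IsOuterNormal.outerNormal_eq (hn : IsOuterNormal Ω z n) : outerNormal Ω z = n := by
  have h : ∃ n, IsOuterNormal Ω z n := ⟨n, hn⟩
  rw [outerNormal, dif_pos h]
  exact h.choose_spec.unique hn

lemma norm_outerNormal_le (Ω : Set Plane) (z : Plane) : ‖outerNormal Ω z‖ ≤ 1 := by
  rw [outerNormal]
  split_ifs with h
  · exact h.choose_spec.1.le
  · simp

end OuterNormal

namespace IsChart

variable {Ω U : Set Plane} {e : Plane ≃ᵃⁱ[ℝ] Plane} {f : ℝ → ℝ} {K : ℝ≥0} {s : ℝ}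

lemma mem_range_of_mem_frontier (h : IsChart Ω U e f K) {p : Plane} (hp : p ∈ U)
    (hfr : p ∈ frontier Ω) : p ∈ range (chartCurve e f) := by
  have hU : U ∈ 𝓝 p := h.isOpen.mem_nhds hp
  have hx : ContinuousAt (fun q => f (e q 0)) p :=
    (h.lipschitz.continuous.comp (continuous_coord e 0)).continuousAt
  have hy : ContinuousAt (fun q => e q 1) p := (continuous_coord e 1).continuousAt
  refine mem_range_chartCurve.2 (le_antisymm (not_lt.1 fun hgt => ?_) (not_lt.1 fun hlt => ?_))
  · refine hfr.2 (mem_interior_iff_mem_nhds.2 ?_)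
    filter_upwards [hU, hx.eventually_lt hy hgt] with q hq hq' using (h.mem_iff q hq).2 hq'
  · refine mem_closure_iff_frequently.1 hfr.1 ?_
    filter_upwards [hU, hy.eventually_lt hx hlt] with q hq hq' hqΩ
    exact lt_asymm ((h.mem_iff q hq).1 hqΩ) hq'

lemma mem_frontier_of_mem_range (h : IsChart Ω U e f K) {p : Plane} (hp : p ∈ U)
    (hr : p ∈ range (chartCurve e f)) : p ∈ frontier Ω := by
  rw [mem_range_chartCurve] at hr
  refine ⟨mem_closure_iff_frequently.2 ?_,
    fun hint => ((h.mem_iff p hp).1 (interior_subset hint)).ne' hr⟩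
  have hup := tendsto_add_smul_nhdsGT_zero p (e.linearIsometryEquiv.symm !₂[0, 1])
  refine hup.frequently (Eventually.frequently ?_)
  filter_upwards [hup.eventually (h.isOpen.mem_nhds hp), self_mem_nhdsWithin] with t htU ht
  rw [h.mem_iff _ htU, add_comm, ← vadd_eq_add, e.map_vadd]
  simpa [hr] using ht

lemma inter_frontier (h : IsChart Ω U e f K) :
    U ∩ frontier Ω = U ∩ range (chartCurve e f) :=
  Subset.antisymm (fun _ hp => ⟨hp.1, h.mem_range_of_mem_frontier hp.1 hp.2⟩)
    fun _ hp => ⟨hp.1, h.mem_frontier_of_mem_range hp.1 hp.2⟩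

lemma isOuterNormal (h : IsChart Ω U e f K) (hs : chartCurve e f s ∈ U)
    (hd : DifferentiableAt ℝ f s) :
    IsOuterNormal Ω (chartCurve e f s) (chartNormal e f s) := by
  refine ⟨norm_chartNormal e f s, fun ε hε => ?_⟩
  set z := chartCurve e f s
  have hez : e z = !₂[s, f s] := apply_chartCurve e
  have hcoord : Tendsto (fun q : Plane => e q 0) (𝓝 z) (𝓝 s) := by
    simpa [hez] using (continuous_coord e 0).tendsto z
  filter_upwards [hcoord.eventually ((hasDerivAt_iff_isLittleO.1 hd.hasDerivAt).def hε),
    h.isOpen.mem_nhds hs] with p hp hpU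
  have hsub : e.linearIsometryEquiv (p - z) = e p - !₂[s, f s] := hez ▸ e.map_vsub p z
  have hle : |e p 0 - s| ≤ ‖p - z‖ := by
    rw [← e.linearIsometryEquiv.norm_map, hsub]
    simpa using PiLp.norm_apply_le (e p - !₂[s, f s]) 0
  have hf : |f (e p 0) - f s - (e p 0 - s) * deriv f s| ≤ ε * ‖p - z‖ :=
    hp.trans (mul_le_mul_of_nonneg_left hle hε.le)
  have harc : ε * ‖p - z‖ ≤ ε * ‖p - z‖ * arcDensity f s :=
    le_mul_of_one_le_right (by positivity) (one_le_arcDensity f s)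
  rw [inner_chartNormal, hsub, h.mem_iff p hpU, ← div_eq_inv_mul,
    div_lt_iff₀ (arcDensity_pos f s), lt_div_iff₀ (arcDensity_pos f s)]
  simp only [PiLp.sub_apply, Matrix.cons_val_zero, Matrix.cons_val_one, Matrix.cons_val_fin_one,
    not_lt]
  constructor <;> intro <;> linarith [abs_le.1 hf]

lemma outerNormal_eq (h : IsChart Ω U e f K) (hs : chartCurve e f s ∈ U)
    (hd : DifferentiableAt ℝ f s) :
    outerNormal Ω (chartCurve e f s) = chartNormal e f s :=
  (h.isOuterNormal hs hd).outerNormal_eq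

lemma measurableEmbedding (h : IsChart Ω U e f K) : MeasurableEmbedding (chartCurve e f) :=
  (isClosedEmbedding_chartCurve e h.lipschitz).measurableEmbedding

lemma measurableSet_preimage (h : IsChart Ω U e f K) : MeasurableSet (chartCurve e f ⁻¹' U) :=
  h.measurableEmbedding.measurable h.isOpen.measurableSet

lemma boundaryMeasure_restrict (h : IsChart Ω U e f K) :
    (boundaryMeasure Ω).restrict U =
      ((volume.restrict (chartCurve e f ⁻¹' U)).withDensity
        fun s => ENNReal.ofReal (arcDensity f s)).map (chartCurve e f) := by
  have hU := h.isOpen.measurableSet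
  have hdensity : (fun s => ‖deriv (chartCurve e f) s‖ₑ) =ᵐ[volume]
      fun s => ENNReal.ofReal (arcDensity f s) := by
    filter_upwards [h.lipschitz.ae_differentiableAt_real] with s hd
    rw [← norm_deriv_chartCurve e hd, ofReal_norm]
  rw [boundaryMeasure, Measure.restrict_restrict hU, h.inter_frontier,
    ← Measure.restrict_restrict hU,
    hausdorffMeasure_restrict_range (antilipschitzWith_chartCurve e f).injective
      (lipschitzWith_chartCurve e h.lipschitz),
    withDensity_congr_ae hdensity, Measure.restrict_map h.measurableEmbedding.measurable hU,
    restrict_withDensity h.measurableSet_preimage]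

lemma ae_restrict_iff (h : IsChart Ω U e f K) {P : Plane → Prop} :
    (∀ᵐ z ∂((boundaryMeasure Ω).restrict U), P z) ↔
      ∀ᵐ s, chartCurve e f s ∈ U → P (chartCurve e f s) := by
  rw [h.boundaryMeasure_restrict, h.measurableEmbedding.ae_map_iff,
    ae_withDensity_iff (measurable_arcDensity f).ennreal_ofReal,
    MeasureTheory.ae_restrict_iff' h.measurableSet_preimage]
  simp [arcDensity_pos f]

lemma ae_isOuterNormal (h : IsChart Ω U e f K) :
    ∀ᵐ z ∂((boundaryMeasure Ω).restrict U), IsOuterNormal Ω z (outerNormal Ω z) := by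
  rw [h.ae_restrict_iff]
  filter_upwards [h.lipschitz.ae_differentiableAt_real] with s hd hs
  rw [h.outerNormal_eq hs hd]
  exact h.isOuterNormal hs hd

lemma aemeasurable_outerNormal (h : IsChart Ω U e f K) :
    AEMeasurable (outerNormal Ω) ((boundaryMeasure Ω).restrict U) := by
  rw [h.boundaryMeasure_restrict, h.measurableEmbedding.aemeasurable_map_iff]
  refine ⟨chartNormal e f, measurable_chartNormal e f,
    (withDensity_absolutelyContinuous _ _).ae_le ?_⟩
  refine (MeasureTheory.ae_restrict_iff' h.measurableSet_preimage).2 ?_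
  filter_upwards [h.lipschitz.ae_differentiableAt_real] with s hd hs using h.outerNormal_eq hs hd

lemma integral_mul_inner_outerNormal (h : IsChart Ω U e f K) {g : Plane → ℝ}
    (hg : ∀ z ∉ U, g z = 0) (v : Plane) :
    ∫ z, g z * inner ℝ v (outerNormal Ω z) ∂(boundaryMeasure Ω) =
      ∫ s, g (chartCurve e f s) *
        (deriv f s * e.linearIsometryEquiv v 0 - e.linearIsometryEquiv v 1) := by
  rw [← setIntegral_eq_integral_of_forall_compl_eq_zero (s := U)
      fun z hz => by rw [hg z hz, zero_mul],
    ← setIntegral_eq_integral_of_forall_compl_eq_zero (s := chartCurve e f ⁻¹' U) (μ := volume)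
      fun s hs => by rw [hg _ hs, zero_mul],
    h.boundaryMeasure_restrict, h.measurableEmbedding.integral_map,
    integral_withDensity_eq_integral_toReal_smul (measurable_arcDensity f).ennreal_ofReal
      (Eventually.of_forall fun _ => ENNReal.ofReal_lt_top)]
  refine setIntegral_congr_ae h.measurableSet_preimage ?_
  filter_upwards [h.lipschitz.ae_differentiableAt_real] with s hd hs
  rw [h.outerNormal_eq hs hd, inner_chartNormal, ENNReal.toReal_ofReal (arcDensity_pos f s).le,
    smul_eq_mul]
  field_simp [(arcDensity_pos f s).ne']

end IsChart

lemma IsBoundedLipschitz.exists_chart {Ω : Set Plane} (hΩ : IsBoundedLipschitz Ω) {z : Plane}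
    (hz : z ∈ frontier Ω) : ∃ U e f K, z ∈ U ∧ IsChart Ω U e f K := by
  obtain ⟨e, f, K, hf, hev⟩ := hΩ.boundary z hz
  obtain ⟨U, hU, hUo, hzU⟩ := eventually_nhds_iff.1 hev
  exact ⟨U, e, f, K, hzU, hUo, hf, hU⟩

section LineDeriv

variable {E : Type*} [NormedAddCommGroup E] [NormedSpace ℝ E] {g : E → ℝ} {C : ℝ≥0}

lemma lineDeriv_eq_zero_of_notMem_tsupport {z : E} (hz : z ∉ tsupport g) (v : E) :
    lineDeriv ℝ g z v = 0 := by
  rw [(notMem_tsupport_iff_eventuallyEq.1 hz).lineDeriv_eq]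
  simp [lineDeriv]

lemma integrable_lineDeriv [FiniteDimensional ℝ E] [MeasurableSpace E] [BorelSpace E]
    {μ : Measure E} [μ.IsAddHaarMeasure] (hg : LipschitzWith C g) (hc : HasCompactSupport g)
    (v : E) : Integrable (fun z => lineDeriv ℝ g z v) μ := by
  have hint := (hg.locallyIntegrable_lineDeriv (μ := μ) v).integrableOn_isCompact hc
  refine (integrableOn_iff_integrable_of_support_subset fun z hz => ?_).1 hint
  by_contra hmem
  exact hz (lineDeriv_eq_zero_of_notMem_tsupport hmem v)

end LineDeriv

section HalfPlane

variable {C : ℝ≥0}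

lemma integral_Ioi_deriv_eq_neg {φ : ℝ → ℝ} (hφ : LipschitzWith C φ) (hc : HasCompactSupport φ)
    (a : ℝ) : ∫ r in Ioi a, deriv φ r = -φ a := by
  obtain ⟨b, hab, hb⟩ : ∃ b, a ≤ b ∧ ∀ r ∈ tsupport φ, r < b := by
    obtain ⟨R, hR⟩ := hc.isBounded.bddAbove
    exact ⟨max a (R + 1), le_max_left _ _, fun r hr =>
      (hR hr).trans_lt ((lt_add_one R).trans_le (le_max_right _ _))⟩
  have hzero : ∀ r, r ∈ Ioi a \ Ioc a b → deriv φ r = 0 := fun r hr =>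
    image_eq_zero_of_notMem_tsupport fun hmem =>
      hr.2 ⟨hr.1, (hb r (tsupport_deriv_subset hmem)).le⟩
  rw [setIntegral_eq_of_subset_of_forall_sdiff_eq_zero measurableSet_Ioi Ioc_subset_Ioi_self
    hzero, ← intervalIntegral.integral_of_le hab,
    (hφ.lipschitzOnWith.absolutelyContinuousOnInterval).integral_deriv_eq_sub,
    image_eq_zero_of_notMem_tsupport fun hmem => (hb b hmem).false, zero_sub]

lemma integral_deriv_eq_zero {φ : ℝ → ℝ} (hφ : LipschitzWith C φ) (hc : HasCompactSupport φ) :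
    ∫ r, deriv φ r = 0 := by
  obtain ⟨R, hR⟩ := hc.isBounded.bddBelow
  have ha : ∀ r ∈ tsupport φ, R - 1 < r := fun r hr => (sub_one_lt R).trans_le (hR hr)
  rw [← setIntegral_eq_integral_of_forall_compl_eq_zero (s := Ioi (R - 1)) fun r hr =>
      image_eq_zero_of_notMem_tsupport fun hmem => hr (ha r (tsupport_deriv_subset hmem)),
    integral_Ioi_deriv_eq_neg hφ hc,
    image_eq_zero_of_notMem_tsupport fun hmem => (ha _ hmem).false, neg_zero]

variable {h : ℝ × ℝ → ℝ}

lemma isClosedEmbedding_prodMk_left (s : ℝ) : IsClosedEmbedding fun r : ℝ => (s, r) :=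
  (Isometry.of_dist_eq fun _ _ => dist_prod_same_left).isClosedEmbedding

lemma isClosedEmbedding_prodMk_right (r : ℝ) : IsClosedEmbedding fun s : ℝ => (s, r) :=
  (Isometry.of_dist_eq fun _ _ => dist_prod_same_right).isClosedEmbedding

lemma lineDeriv_prod_fst (h : ℝ × ℝ → ℝ) (s r : ℝ) :
    lineDeriv ℝ h (s, r) (1, 0) = deriv (fun s => h (s, r)) s := by
  simpa [lineDeriv] using deriv_comp_const_add (fun s => h (s, r)) s 0

lemma lineDeriv_prod_snd (h : ℝ × ℝ → ℝ) (s r : ℝ) :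
    lineDeriv ℝ h (s, r) (0, 1) = deriv (fun r => h (s, r)) r := by
  simpa [lineDeriv] using deriv_comp_const_add (fun r => h (s, r)) r 0

lemma integral_halfPlane_lineDeriv_fst (hh : LipschitzWith C h) (hc : HasCompactSupport h) :
    ∫ q in univ ×ˢ Ioi (0 : ℝ), lineDeriv ℝ h q (1, 0) = 0 := by
  rw [Measure.volume_eq_prod, ← Measure.prod_restrict, integral_prod_symm]
  · refine integral_eq_zero_of_ae (Eventually.of_forall fun r => ?_)
    simp only [lineDeriv_prod_fst, Measure.restrict_univ]
    exact integral_deriv_eq_zero (hh.comp (LipschitzWith.prodMk_right r))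
      (hc.comp_isClosedEmbedding (isClosedEmbedding_prodMk_right r))
  · rw [Measure.prod_restrict, ← Measure.volume_eq_prod]
    exact (integrable_lineDeriv hh hc _).integrableOn

lemma integral_halfPlane_mul_lineDeriv_snd (hh : LipschitzWith C h) (hc : HasCompactSupport h)
    {a : ℝ → ℝ} (ha : Measurable a) {M : ℝ} (hM : ∀ s, ‖a s‖ ≤ M) :
    IntegrableOn (fun q => a q.1 * lineDeriv ℝ h q (0, 1)) (univ ×ˢ Ioi (0 : ℝ)) ∧
    ∫ q in univ ×ˢ Ioi (0 : ℝ), a q.1 * lineDeriv ℝ h q (0, 1) = -∫ s, a s * h (s, 0) := by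
  have hint : Integrable fun q : ℝ × ℝ => a q.1 * lineDeriv ℝ h q (0, 1) :=
    (integrable_lineDeriv hh hc _).bdd_mul (ha.comp measurable_fst).aestronglyMeasurable
      (Eventually.of_forall fun q => hM q.1)
  refine ⟨hint.integrableOn, ?_⟩
  rw [Measure.volume_eq_prod, setIntegral_prod _ hint.integrableOn, ← integral_neg]
  simp only [lineDeriv_prod_snd, Measure.restrict_univ, integral_const_mul]
  congr 1 with s
  have hs : ∫ r in Ioi 0, deriv (fun r => h (s, r)) r = -h (s, 0) :=
    integral_Ioi_deriv_eq_neg (hh.comp (LipschitzWith.prodMk_left s))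
      (hc.comp_isClosedEmbedding (isClosedEmbedding_prodMk_left s)) 0
  rw [hs, mul_neg]

end HalfPlane

section Shear

/-- The change of variables `(s, r) ↦ (s, f s + r)`, which straightens the graph of `f`. -/
def graphShear {f : ℝ → ℝ} (hf : Continuous f) : ℝ × ℝ ≃ₜ Plane where
  toFun q := !₂[q.1, f q.1 + q.2]
  invFun p := (p 0, p 1 - f (p 0))
  left_inv q := by simp
  right_inv p := by ext i; fin_cases i <;> simp
  continuous_toFun := by fun_prop
  continuous_invFun := by fun_prop

variable {f : ℝ → ℝ} {K C : ℝ≥0} {g : Plane → ℝ}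

lemma measurePreserving_graphShear (hf : Continuous f) :
    MeasurePreserving (graphShear hf) volume volume :=
  (PiLp.volume_preserving_toLp (Fin 2)).comp <|
    (volume_preserving_finTwoArrow ℝ).symm.comp <|
      (MeasurePreserving.id volume).skew_product (g := fun s r => f s + r) (by fun_prop)
        (Eventually.of_forall fun s => (measurePreserving_add_left volume (f s)).map_eq)

lemma exists_lipschitzWith_graphShear (hf : LipschitzWith K f) :
    ∃ D, LipschitzWith D (graphShear hf.continuous) := by
  have hsnd : LipschitzWith (K * 1 + 1) fun q : ℝ × ℝ => f q.1 + q.2 :=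
    (hf.comp LipschitzWith.prod_fst).add LipschitzWith.prod_snd
  have hpair : LipschitzWith (K * 1 + 1) fun q : ℝ × ℝ => ![q.1, f q.1 + q.2] :=
    LipschitzWith.of_dist_le_mul fun p q => (dist_pi_le_iff (by positivity)).2 <|
      Fin.forall_fin_two.2 ⟨(LipschitzWith.prod_fst.weaken le_add_self).dist_le_mul p q,
        hsnd.dist_le_mul p q⟩
  exact ⟨_, (PiLp.lipschitzWith_toLp 2 _).comp hpair⟩

lemma lineDeriv_comp_graphShear (hf : Continuous f) {q : ℝ × ℝ} (hd : DifferentiableAt ℝ f q.1)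
    (hg : DifferentiableAt ℝ g (graphShear hf q)) (v : ℝ × ℝ) :
    lineDeriv ℝ (g ∘ graphShear hf) q v =
      fderiv ℝ g (graphShear hf q) !₂[v.1, deriv f q.1 * v.1 + v.2] := by
  have hlin (a b : ℝ) : HasDerivAt (fun t => a + t * b) b 0 := by
    simpa using ((hasDerivAt_id (0 : ℝ)).mul_const b).const_add a
  have hfst : HasDerivAt (fun t => f (q.1 + t * v.1)) (deriv f q.1 * v.1) 0 :=
    HasDerivAt.comp (0 : ℝ) (by simpa using hd.hasDerivAt) (hlin q.1 v.1)
  have hcurve : HasDerivAt (fun t : ℝ => graphShear hf (q + t • v))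
      !₂[v.1, deriv f q.1 * v.1 + v.2] 0 :=
    hasDerivAt_planeMk (hlin q.1 v.1) (hfst.add (hlin q.2 v.2))
  refine HasDerivAt.deriv (HasFDerivAt.comp_hasDerivAt (0 : ℝ) ?_ hcurve)
  simpa using hg.hasFDerivAt

lemma lineDeriv_graphShear (hf : Continuous f) {q : ℝ × ℝ} (hd : DifferentiableAt ℝ f q.1)
    (hg : DifferentiableAt ℝ g (graphShear hf q)) (w : Plane) :
    lineDeriv ℝ g (graphShear hf q) w = w 0 * lineDeriv ℝ (g ∘ graphShear hf) q (1, 0) +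
      (w 1 - deriv f q.1 * w 0) * lineDeriv ℝ (g ∘ graphShear hf) q (0, 1) := by
  have hw : w = w 0 • !₂[1, deriv f q.1] + (w 1 - deriv f q.1 * w 0) • !₂[0, 1] := by
    ext i
    fin_cases i <;> simp [mul_comm]
  rw [hg.lineDeriv_eq_fderiv, lineDeriv_comp_graphShear hf hd hg,
    lineDeriv_comp_graphShear hf hd hg]
  conv_lhs => rw [hw]
  simp

theorem integral_epigraph_lineDeriv (hf : LipschitzWith K f) (hg : LipschitzWith C g)
    (hc : HasCompactSupport g) (w : Plane) :
    ∫ z in {p : Plane | f (p 0) < p 1}, lineDeriv ℝ g z w =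
      ∫ s, g !₂[s, f s] * (deriv f s * w 0 - w 1) := by
  set S := graphShear hf.continuous
  have hS : MeasurePreserving S volume volume := measurePreserving_graphShear hf.continuous
  have hpre : S ⁻¹' {p : Plane | f (p 0) < p 1} = univ ×ˢ Ioi 0 := by
    ext q
    simp [S, graphShear]
  obtain ⟨D, hD⟩ := exists_lipschitzWith_graphShear hf
  have hh : LipschitzWith (C * D) (g ∘ S) := hg.comp hD
  have hhc : HasCompactSupport (g ∘ S) := hc.comp_homeomorph S
  have hbound (s : ℝ) : ‖w 1 - deriv f s * w 0‖ ≤ ‖w 1‖ + K * ‖w 0‖ :=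
    (norm_sub_le _ _).trans (by
      rw [norm_mul]
      gcongr
      exact norm_deriv_le_of_lipschitz hf)
  obtain ⟨hint, hsnd⟩ := integral_halfPlane_mul_lineDeriv_snd hh hhc
    (a := fun s => w 1 - deriv f s * w 0)
    (measurable_const.sub ((measurable_deriv f).mul_const (w 0))) hbound
  have hchain : ∀ᵐ q, lineDeriv ℝ g (S q) w = w 0 * lineDeriv ℝ (g ∘ S) q (1, 0) +
      (w 1 - deriv f q.1 * w 0) * lineDeriv ℝ (g ∘ S) q (0, 1) := by
    filter_upwards [hS.quasiMeasurePreserving.ae hg.ae_differentiableAt,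
      Measure.quasiMeasurePreserving_fst.ae hf.ae_differentiableAt_real] with q hgq hfq
      using lineDeriv_graphShear hf.continuous hfq hgq w
  calc ∫ z in {p : Plane | f (p 0) < p 1}, lineDeriv ℝ g z w
      = ∫ q in univ ×ˢ Ioi 0, lineDeriv ℝ g (S q) w := by
        rw [← hpre]
        exact (hS.setIntegral_preimage_emb S.measurableEmbedding
          (fun z => lineDeriv ℝ g z w) _).symm
    _ = ∫ q in univ ×ˢ Ioi 0, (w 0 * lineDeriv ℝ (g ∘ S) q (1, 0) +
          (w 1 - deriv f q.1 * w 0) * lineDeriv ℝ (g ∘ S) q (0, 1)) :=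
        integral_congr_ae (ae_restrict_of_ae hchain)
    _ = -∫ s, (w 1 - deriv f s * w 0) * g !₂[s, f s] := by
        rw [integral_add ((integrable_lineDeriv hh hhc _).integrableOn.const_mul _) hint,
          integral_const_mul, integral_halfPlane_lineDeriv_fst hh hhc, hsnd, mul_zero, zero_add]
        simp [S, graphShear]
    _ = ∫ s, g !₂[s, f s] * (deriv f s * w 0 - w 1) := by
        rw [← integral_neg]
        congr 1 with s
        ring

end Shear

section Chart

lemma measurePreserving_affineIsometryEquiv (e : Plane ≃ᵃⁱ[ℝ] Plane) :
    MeasurePreserving e volume volume := by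
  have he : (e : Plane → Plane) = (fun z => z + e 0) ∘ e.linearIsometryEquiv := funext fun z => by
    simpa using e.map_vadd 0 z
  rw [he]
  exact (measurePreserving_add_right volume (e 0)).comp e.linearIsometryEquiv.measurePreserving

lemma lineDeriv_comp_symm (e : Plane ≃ᵃⁱ[ℝ] Plane) (g : Plane → ℝ) (z v : Plane) :
    lineDeriv ℝ (g ∘ e.symm) (e z) (e.linearIsometryEquiv v) = lineDeriv ℝ g z v := by
  have hline (t : ℝ) : e.symm (e z + t • e.linearIsometryEquiv v) = z + t • v := by
    rw [AffineIsometryEquiv.symm_apply_eq, ← map_smul, add_comm, add_comm z]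
    exact (e.map_vadd z (t • v)).symm
  simp only [lineDeriv, Function.comp_def, hline]

theorem IsChart.integral_lineDeriv {Ω U : Set Plane} {e : Plane ≃ᵃⁱ[ℝ] Plane} {f : ℝ → ℝ}
    {K C : ℝ≥0} (h : IsChart Ω U e f K) (hΩ : MeasurableSet Ω) {g : Plane → ℝ}
    (hg : LipschitzWith C g) (hc : HasCompactSupport g) (hU : tsupport g ⊆ U) (v : Plane) :
    ∫ z in Ω, lineDeriv ℝ g z v =
      ∫ z, g z * inner ℝ v (outerNormal Ω z) ∂(boundaryMeasure Ω) := by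
  set S : Set Plane := {p | f (p 0) < p 1}
  have hS : MeasurableSet (e ⁻¹' S) := (isOpen_lt (h.lipschitz.continuous.comp
    (continuous_coord e 0)) (continuous_coord e 1)).measurableSet
  have hg' : LipschitzWith C (g ∘ e.symm) := by
    simpa using hg.comp e.symm.isometry.lipschitz
  have hc' : HasCompactSupport (g ∘ e.symm) := hc.comp_homeomorph e.symm.toHomeomorph
  have hindicator : Ω.indicator (fun z => lineDeriv ℝ g z v) =
      (e ⁻¹' S).indicator fun z => lineDeriv ℝ g z v := by
    classical
    ext z
    by_cases hz : z ∈ tsupport g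
    · have hiff : z ∈ Ω ↔ z ∈ e ⁻¹' S := h.mem_iff z (hU hz)
      simp only [indicator_apply, hiff]
    · simp only [indicator_apply, lineDeriv_eq_zero_of_notMem_tsupport hz, ite_self]
  calc ∫ z in Ω, lineDeriv ℝ g z v = ∫ z in e ⁻¹' S, lineDeriv ℝ g z v := by
        rw [← integral_indicator hΩ, hindicator, integral_indicator hS]
    _ = ∫ z in S, lineDeriv ℝ (g ∘ e.symm) z (e.linearIsometryEquiv v) := by
        simpa only [lineDeriv_comp_symm] using
          (measurePreserving_affineIsometryEquiv e).setIntegral_preimage_emb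
            e.toHomeomorph.measurableEmbedding
            (fun z => lineDeriv ℝ (g ∘ e.symm) z (e.linearIsometryEquiv v)) S
    _ = ∫ z, g z * inner ℝ v (outerNormal Ω z) ∂(boundaryMeasure Ω) := by
        rw [integral_epigraph_lineDeriv h.lipschitz hg' hc',
          h.integral_mul_inner_outerNormal fun z hz =>
            image_eq_zero_of_notMem_tsupport fun hz' => hz (hU hz')]
        rfl

end Chart

variable {Ω : Set Plane}

section TestFunctions

lemma exists_lipschitzWith_mul {X : Type*} [PseudoMetricSpace X] {f g : X → ℝ} {A B : ℝ≥0}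
    (hf : LipschitzWith A f) (hfc : HasCompactSupport f) (hg : LipschitzWith B g) :
    ∃ C, LipschitzWith C fun x => f x * g x := by
  obtain ⟨a, ha⟩ := hfc.exists_bound_of_continuous hf.continuous
  obtain ⟨b, hb⟩ := IsCompact.exists_bound_of_continuousOn hfc hg.continuous.continuousOn
  have hmem (x y : X) (hx : x ∈ tsupport f) :
      dist (f x * g x) (f y * g y) ≤ (|a| * B + |b| * A) * dist x y := by
    calc dist (f x * g x) (f y * g y) = ‖f y * (g x - g y) + (f x - f y) * g x‖ := by
          rw [dist_eq_norm]
          congr 1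
          ring
      _ ≤ ‖f y‖ * dist (g x) (g y) + dist (f x) (f y) * ‖g x‖ := by
          rw [dist_eq_norm, dist_eq_norm, ← norm_mul, ← norm_mul]
          exact norm_add_le _ _
      _ ≤ |a| * (B * dist x y) + A * dist x y * |b| := by
          gcongr
          · exact (ha y).trans (le_abs_self a)
          · exact hg.dist_le_mul x y
          · exact hf.dist_le_mul x y
          · exact (hb x hx).trans (le_abs_self b)
      _ = (|a| * B + |b| * A) * dist x y := by ring
  refine ⟨Real.toNNReal (|a| * B + |b| * A), LipschitzWith.of_dist_le_mul fun x y => ?_⟩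
  rw [Real.coe_toNNReal _ (by positivity)]
  by_cases hx : x ∈ tsupport f
  · exact hmem x y hx
  by_cases hy : y ∈ tsupport f
  · simpa only [dist_comm] using hmem y x hy
  rw [image_eq_zero_of_notMem_tsupport hx, image_eq_zero_of_notMem_tsupport hy, zero_mul,
    zero_mul, dist_self]
  positivity

lemma IsTest.exists_lipschitzWith {ζ : Plane → ℝ} (hζ : IsTest Ω ζ) : ∃ C, LipschitzWith C ζ :=
  ContDiff.lipschitzWith_of_hasCompactSupport hζ.2.1 hζ.1 (by simp)

lemma IsTest.mul_left {ζ ψ : Plane → ℝ} (hζ : IsTest Ω ζ) (hψ : ContDiff ℝ ∞ ψ) :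
    IsTest Ω fun z => ζ z * ψ z :=
  ⟨hζ.1.mul hψ, hζ.2.1.mul_right, tsupport_mul_subset_left.trans hζ.2.2⟩

lemma exists_isTest_univ_eqOn_one {S : Set Plane} (hS : Bornology.IsBounded S) :
    ∃ χ, IsTest univ χ ∧ EqOn χ 1 S := by
  obtain ⟨R, hR⟩ := hS.subset_closedBall 0
  let χ : ContDiffBump (0 : Plane) :=
    ⟨max R 1, max R 1 + 1, lt_max_of_lt_right one_pos, lt_add_one _⟩
  exact ⟨χ, ⟨χ.contDiff, χ.hasCompactSupport, subset_univ _⟩, fun z hz =>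
    χ.one_of_mem_closedBall (Metric.closedBall_subset_closedBall (le_max_left _ _) (hR hz))⟩

lemma exists_smooth_partition {S : Set Plane} (hS : IsCompact S) {P : Set Plane → Prop}
    (hP : ∀ z ∈ S, ∃ U, IsOpen U ∧ z ∈ U ∧ P U) :
    ∃ (ι : Type) (_ : Fintype ι) (ζ : ι → Plane → ℝ),
      (∀ i, (∀ p, 0 ≤ ζ i p) ∧ ∃ U, IsOpen U ∧ P U ∧ IsTest U (ζ i)) ∧
        ∀ p ∈ S, ∑ i, ζ i p = 1 := by
  choose! U hUo hzU hPU using hP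
  obtain ⟨t, htS, hcov⟩ := hS.elim_nhds_subcover (fun z => U z ∩ Metric.ball z 1) fun z hz =>
    inter_mem ((hUo z hz).mem_nhds (hzU z hz)) (Metric.ball_mem_nhds z one_pos)
  obtain ⟨ρ, hρ⟩ := SmoothPartitionOfUnity.exists_isSubordinate (modelWithCornersSelf ℝ Plane)
    hS.isClosed (fun z : t => U z ∩ Metric.ball (z : Plane) 1)
    (fun z => (hUo z (htS z z.2)).inter Metric.isOpen_ball)
    (hcov.trans (iUnion₂_subset fun z hz => subset_iUnion_of_subset ⟨z, hz⟩ subset_rfl))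
  refine ⟨t, inferInstance, fun z => ρ z, fun z => ⟨ρ.nonneg z, U z, hUo z (htS z z.2),
    hPU z (htS z z.2), (ρ z).contMDiff.contDiff, ?_, (hρ z).trans inter_subset_left⟩,
    fun p hp => ?_⟩
  · exact HasCompactSupport.of_support_subset_isCompact (isCompact_closedBall (z : Plane) 1)
      ((subset_tsupport _).trans ((hρ z).trans
        (inter_subset_right.trans Metric.ball_subset_closedBall)))
  · rw [← finsum_eq_sum_of_fintype]
    exact ρ.sum_eq_one hp

end TestFunctions

section BoundaryMeasure

lemma ae_mem_frontier (Ω : Set Plane) : ∀ᵐ z ∂(boundaryMeasure Ω), z ∈ frontier Ω :=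
  ae_restrict_mem isClosed_frontier.measurableSet

lemma isCompact_frontier (hΩ : IsBoundedLipschitz Ω) : IsCompact (frontier Ω) :=
  hΩ.isBounded.isCompact_closure.of_isClosed_subset isClosed_frontier frontier_subset_closure

lemma isFiniteMeasure_boundaryMeasure (hΩ : IsBoundedLipschitz Ω) :
    IsFiniteMeasure (boundaryMeasure Ω) := by
  refine ⟨?_⟩
  rw [boundaryMeasure, Measure.restrict_apply_univ]
  refine (isCompact_frontier hΩ).measure_lt_top_of_nhdsWithin fun z hz => ?_
  obtain ⟨U, e, f, K, hzU, h⟩ := hΩ.exists_chart hz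
  refine ⟨frontier Ω ∩ (U ∩ Metric.ball z 1), inter_mem_nhdsWithin _
    (inter_mem (h.isOpen.mem_nhds hzU) (Metric.ball_mem_nhds z one_pos)), ?_⟩
  have hsub : frontier Ω ∩ (U ∩ Metric.ball z 1) ⊆
      chartCurve e f '' (chartCurve e f ⁻¹' Metric.ball z 1) := by
    rintro p ⟨hp, hpU, hpb⟩
    obtain ⟨s, rfl⟩ := h.mem_range_of_mem_frontier hpU hp
    exact ⟨s, hpb, rfl⟩
  have hbdd : Bornology.IsBounded (chartCurve e f ⁻¹' Metric.ball z 1) :=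
    (antilipschitzWith_chartCurve e f).isBounded_preimage Metric.isBounded_ball
  calc μH[1] (frontier Ω ∩ (U ∩ Metric.ball z 1))
      ≤ μH[1] (chartCurve e f '' (chartCurve e f ⁻¹' Metric.ball z 1)) := measure_mono hsub
    _ ≤ ((1 + K : ℝ≥0) : ℝ≥0∞) ^ (1 : ℝ) * μH[1] (chartCurve e f ⁻¹' Metric.ball z 1) :=
        (lipschitzWith_chartCurve e h.lipschitz).hausdorffMeasure_image_le zero_le_one _
    _ < ⊤ := by
        rw [hausdorffMeasure_real, ENNReal.rpow_one]
        exact ENNReal.mul_lt_top ENNReal.coe_lt_top hbdd.measure_lt_top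

lemma IsBoundedLipschitz.exists_countable_charts (hΩ : IsBoundedLipschitz Ω) :
    ∃ (ι : Type) (_ : Countable ι) (U : ι → Set Plane), (∀ i, ∃ e f K, IsChart Ω (U i) e f K) ∧
      (boundaryMeasure Ω).restrict (⋃ i, U i) = boundaryMeasure Ω := by
  choose! U e f K hzU hU using fun z (hz : z ∈ frontier Ω) => hΩ.exists_chart hz
  obtain ⟨t, htS, hcov⟩ := (isCompact_frontier hΩ).elim_nhds_subcover U fun z hz =>
    (hU z hz).isOpen.mem_nhds (hzU z hz)
  refine ⟨t, inferInstance, fun z => U z, fun z => ⟨e z, f z, K z, hU z (htS z z.2)⟩,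
    Measure.restrict_eq_self_of_ae_mem ?_⟩
  filter_upwards [ae_mem_frontier Ω] with p hp
  obtain ⟨z, hz, hpz⟩ := mem_iUnion₂.1 (hcov hp)
  exact mem_iUnion.2 ⟨⟨z, hz⟩, hpz⟩

lemma ae_isOuterNormal (hΩ : IsBoundedLipschitz Ω) :
    ∀ᵐ z ∂(boundaryMeasure Ω), IsOuterNormal Ω z (outerNormal Ω z) := by
  obtain ⟨ι, _, U, hU, hcov⟩ := hΩ.exists_countable_charts
  rw [← hcov, ae_restrict_iUnion_iff]
  intro i
  obtain ⟨e, f, K, h⟩ := hU i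
  exact h.ae_isOuterNormal

lemma aemeasurable_outerNormal (hΩ : IsBoundedLipschitz Ω) :
    AEMeasurable (outerNormal Ω) (boundaryMeasure Ω) := by
  obtain ⟨ι, _, U, hU, hcov⟩ := hΩ.exists_countable_charts
  rw [← hcov, aemeasurable_iUnion_iff]
  intro i
  obtain ⟨e, f, K, h⟩ := hU i
  exact h.aemeasurable_outerNormal

lemma memLp_boundary_of_continuousOn (hΩ : IsBoundedLipschitz Ω) {E : Type*}
    [NormedAddCommGroup E] [SecondCountableTopology E] {g : Plane → E}
    (hg : ContinuousOn g (frontier Ω)) (p : ℝ≥0∞) :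
    MemLp g p (boundaryMeasure Ω) := by
  have := isFiniteMeasure_boundaryMeasure hΩ
  obtain ⟨C, hC⟩ := (isCompact_frontier hΩ).exists_bound_of_continuousOn hg
  refine MemLp.of_bound (hg.aestronglyMeasurable isClosed_frontier.measurableSet) C ?_
  filter_upwards [ae_mem_frontier Ω] with z hz using hC z hz

lemma memLp_top_normalFlux (hΩ : IsBoundedLipschitz Ω) {c : Plane → Plane}
    (hc : ContinuousOn c (frontier Ω)) :
    MemLp (normalFlux Ω c) ⊤ (boundaryMeasure Ω) := by
  obtain ⟨C, hC⟩ := (isCompact_frontier hΩ).exists_bound_of_continuousOn hc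
  refine memLp_top_of_bound (AEStronglyMeasurable.inner
    (hc.aestronglyMeasurable isClosed_frontier.measurableSet)
    (aemeasurable_outerNormal hΩ).aestronglyMeasurable) C ?_
  filter_upwards [ae_mem_frontier Ω] with z hz
  calc ‖inner ℝ (c z) (outerNormal Ω z)‖ ≤ ‖c z‖ * ‖outerNormal Ω z‖ := norm_inner_le_norm _ _
    _ ≤ ‖c z‖ := mul_le_of_le_one_right (norm_nonneg _) (norm_outerNormal_le Ω z)
    _ ≤ C := hC z hz

lemma integrable_mul_inner_outerNormal (hΩ : IsBoundedLipschitz Ω) {g : Plane → ℝ}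
    (hg : Continuous g) (v : Plane) :
    Integrable (fun z => g z * inner ℝ v (outerNormal Ω z)) (boundaryMeasure Ω) :=
  (memLp_one_iff_integrable.1 (memLp_boundary_of_continuousOn hΩ hg.continuousOn 1)).mul_of_top_left
    (memLp_top_normalFlux hΩ (c := fun _ => v) continuousOn_const)

end BoundaryMeasure

section DivergenceTheorem

variable {C : ℝ≥0} {g : Plane → ℝ}

lemma integral_lineDeriv_of_tsupport_subset (hΩ : IsOpen Ω) (hg : LipschitzWith C g)
    (hc : HasCompactSupport g) (hU : tsupport g ⊆ Ω) (v : Plane) :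
    ∫ z in Ω, lineDeriv ℝ g z v =
      ∫ z, g z * inner ℝ v (outerNormal Ω z) ∂(boundaryMeasure Ω) := by
  have hboundary : ∫ z, g z * inner ℝ v (outerNormal Ω z) ∂(boundaryMeasure Ω) = 0 := by
    refine setIntegral_eq_zero_of_forall_eq_zero fun z hz => ?_
    rw [hΩ.frontier_eq] at hz
    rw [image_eq_zero_of_notMem_tsupport fun hz' => hz.2 (hU hz'), zero_mul]
  have hspace : ∫ z, lineDeriv ℝ g z v = 0 := by
    simpa [lineDeriv] using ((LipschitzWith.const (α := Plane) (1 : ℝ)).integral_lineDeriv_mul_eq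
      (μ := volume) hg hc (-v)).symm
  rw [hboundary, setIntegral_eq_integral_of_forall_compl_eq_zero, hspace]
  exact fun z hz => lineDeriv_eq_zero_of_notMem_tsupport (fun hz' => hz (hU hz')) v

lemma exists_nhds_integral_lineDeriv_eq_boundary (hΩ : IsBoundedLipschitz Ω) {z : Plane}
    (hz : z ∈ closure Ω) (v : Plane) :
    ∃ U, IsOpen U ∧ z ∈ U ∧ ∀ (g : Plane → ℝ) (C : ℝ≥0), LipschitzWith C g →
      HasCompactSupport g → tsupport g ⊆ U → ∫ z in Ω, lineDeriv ℝ g z v =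
        ∫ z, g z * inner ℝ v (outerNormal Ω z) ∂(boundaryMeasure Ω) := by
  by_cases hzΩ : z ∈ Ω
  · exact ⟨Ω, hΩ.isOpen, hzΩ, fun g C hg hc hU =>
      integral_lineDeriv_of_tsupport_subset hΩ.isOpen hg hc hU v⟩
  · have hzΓ : z ∈ frontier Ω := by
      rw [hΩ.isOpen.frontier_eq]
      exact ⟨hz, hzΩ⟩
    obtain ⟨U, e, f, K, hzU, h⟩ := hΩ.exists_chart hzΓ
    exact ⟨U, h.isOpen, hzU, fun g C hg hc hU =>
      h.integral_lineDeriv hΩ.isOpen.measurableSet hg hc hU v⟩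

lemma ae_sum_lineDeriv_mul_eq (hΩ : IsOpen Ω) {ι : Type*} [Fintype ι] {ζ : ι → Plane → ℝ}
    (hlip : ∀ i, ∃ D, LipschitzWith D fun p => ζ i p * g p) (hsum : ∀ p ∈ Ω, ∑ i, ζ i p = 1)
    (v : Plane) :
    ∀ᵐ p ∂(volume.restrict Ω), ∑ i, lineDeriv ℝ (fun p => ζ i p * g p) p v = lineDeriv ℝ g p v := by
  have hdiff : ∀ᵐ p : Plane, ∀ i, LineDifferentiableAt ℝ (fun p => ζ i p * g p) p v :=
    eventually_all.2 fun i => (hlip i).choose_spec.ae_lineDifferentiableAt v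
  filter_upwards [ae_restrict_of_ae hdiff, ae_restrict_mem hΩ.measurableSet] with p hp hpΩ
  have heq : g =ᶠ[𝓝 p] fun q => ∑ i, ζ i q * g q := by
    filter_upwards [hΩ.mem_nhds hpΩ] with q hq
    rw [← Finset.sum_mul, hsum q hq, one_mul]
  rw [heq.lineDeriv_eq]
  exact (HasDerivAt.fun_sum fun i _ => (hp i).hasLineDerivAt).deriv.symm

theorem integral_lineDeriv_eq_boundary (hΩ : IsBoundedLipschitz Ω) (hg : LipschitzWith C g)
    (v : Plane) :
    ∫ z in Ω, lineDeriv ℝ g z v =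
      ∫ z, g z * inner ℝ v (outerNormal Ω z) ∂(boundaryMeasure Ω) := by
  obtain ⟨ι, _, ζ, hζ, hsum⟩ := exists_smooth_partition hΩ.isBounded.isCompact_closure
    fun z hz => exists_nhds_integral_lineDeriv_eq_boundary hΩ hz v
  choose _ U _ hU hζU using hζ
  have hlip (i) : ∃ D, LipschitzWith D fun p => ζ i p * g p := by
    obtain ⟨A, hA⟩ := (hζU i).exists_lipschitzWith
    exact exists_lipschitzWith_mul hA (hζU i).2.1 hg
  have hcs (i) : HasCompactSupport fun p => ζ i p * g p := (hζU i).2.1.mul_right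
  have hlocal (i) : ∫ p in Ω, lineDeriv ℝ (fun p => ζ i p * g p) p v =
      ∫ p, ζ i p * g p * inner ℝ v (outerNormal Ω p) ∂(boundaryMeasure Ω) := by
    obtain ⟨D, hD⟩ := hlip i
    exact hU i _ D hD (hcs i) (tsupport_mul_subset_left.trans (hζU i).2.2)
  have hint (i) : IntegrableOn (fun p => lineDeriv ℝ (fun p => ζ i p * g p) p v) Ω := by
    obtain ⟨D, hD⟩ := hlip i
    exact (integrable_lineDeriv hD (hcs i) v).integrableOn
  calc ∫ p in Ω, lineDeriv ℝ g p v
      = ∫ p in Ω, ∑ i, lineDeriv ℝ (fun p => ζ i p * g p) p v :=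
        integral_congr_ae ((ae_sum_lineDeriv_mul_eq hΩ.isOpen hlip
          (fun p hp => hsum p (subset_closure hp)) v).mono fun _ => Eq.symm)
    _ = ∑ i, ∫ p, ζ i p * g p * inner ℝ v (outerNormal Ω p) ∂(boundaryMeasure Ω) := by
        simp only [integral_finsetSum _ fun i _ => hint i, hlocal]
    _ = ∫ p, ∑ i, ζ i p * g p * inner ℝ v (outerNormal Ω p) ∂(boundaryMeasure Ω) :=
        (integral_finsetSum _ fun i _ => integrable_mul_inner_outerNormal hΩ
          ((hζU i).1.continuous.mul hg.continuous) v).symm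
    _ = ∫ p, g p * inner ℝ v (outerNormal Ω p) ∂(boundaryMeasure Ω) := by
        refine setIntegral_congr_fun isClosed_frontier.measurableSet fun p hp => ?_
        simp only [← Finset.sum_mul, hsum p (frontier_subset_closure hp), one_mul]

lemma continuous_gradient {ψ : Plane → ℝ} (hψ : ContDiff ℝ ∞ ψ) : Continuous (gradient ψ) :=
  (InnerProductSpace.toDual ℝ Plane).symm.continuous.comp (hψ.continuous_fderiv (by simp))

theorem integral_mul_boundary (hΩ : IsBoundedLipschitz Ω) {ψ b : Plane → ℝ}
    (hψ : ContDiff ℝ ∞ ψ) {B : ℝ≥0} (hb : LipschitzWith B b) (v : Plane) :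
    ∫ z in Ω, (fderiv ℝ ψ z v * b z + ψ z * lineDeriv ℝ b z v) =
      ∫ z, ψ z * b z * inner ℝ v (outerNormal Ω z) ∂(boundaryMeasure Ω) := by
  obtain ⟨χ, hχ, hχ1⟩ := exists_isTest_univ_eqOn_one hΩ.isBounded.closure
  have hφ : IsTest univ fun z => χ z * ψ z := hχ.mul_left hψ
  obtain ⟨A, hA⟩ := hφ.exists_lipschitzWith
  obtain ⟨C, hC⟩ := exists_lipschitzWith_mul hA hφ.2.1 hb
  calc ∫ z in Ω, (fderiv ℝ ψ z v * b z + ψ z * lineDeriv ℝ b z v)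
      = ∫ z in Ω, lineDeriv ℝ (fun z => χ z * ψ z * b z) z v := by
        refine setIntegral_congr_ae hΩ.isOpen.measurableSet ?_
        filter_upwards [hb.ae_lineDifferentiableAt (μ := volume) v] with z hz hzΩ
        have heq : (fun z => χ z * ψ z * b z) =ᶠ[𝓝 z] fun z => ψ z * b z := by
          filter_upwards [hΩ.isOpen.mem_nhds hzΩ] with q hq
          rw [hχ1 (subset_closure hq), Pi.one_apply, one_mul]
        have hψz : HasLineDerivAt ℝ ψ (fderiv ℝ ψ z v) z v :=
          (hψ.differentiable (by simp) z).hasFDerivAt.hasLineDerivAt v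
        have hprod := HasDerivAt.mul hψz hz.hasLineDerivAt
        simp only [zero_smul, add_zero] at hprod
        rw [heq.lineDeriv_eq]
        exact hprod.deriv.symm
    _ = ∫ z, χ z * ψ z * b z * inner ℝ v (outerNormal Ω z) ∂(boundaryMeasure Ω) :=
        integral_lineDeriv_eq_boundary hΩ hC v
    _ = ∫ z, ψ z * b z * inner ℝ v (outerNormal Ω z) ∂(boundaryMeasure Ω) := by
        refine setIntegral_congr_fun isClosed_frontier.measurableSet fun z hz => ?_
        simp only [hχ1 (frontier_subset_closure hz), Pi.one_apply, one_mul]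

end DivergenceTheorem

section TraceInequality

lemma memLp_restrict_of_continuous (hΩ : Bornology.IsBounded Ω) {E : Type*} [NormedAddCommGroup E]
    [SecondCountableTopology E] {g : Plane → E} (hg : Continuous g) (p : ℝ≥0∞) :
    MemLp g p (volume.restrict Ω) := by
  obtain ⟨C, hC⟩ := hΩ.isCompact_closure.exists_bound_of_continuousOn hg.continuousOn
  have : IsFiniteMeasure (volume.restrict (closure Ω)) :=
    ⟨by simpa using hΩ.isCompact_closure.measure_lt_top⟩
  have hcl : MemLp g p (volume.restrict (closure Ω)) :=
    MemLp.of_bound hg.aestronglyMeasurable C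
      (ae_restrict_of_forall_mem isClosed_closure.measurableSet hC)
  exact hcl.mono_measure (Measure.restrict_mono subset_closure le_rfl)

lemma integral_sq_mul_boundary (hΩ : IsBoundedLipschitz Ω) {ψ b : Plane → ℝ}
    (hψ : ContDiff ℝ ∞ ψ) {B : ℝ≥0} (hb : LipschitzWith B b) (v : Plane) :
    ∫ z in Ω, (2 * ψ z * inner ℝ (gradient ψ z) v * b z + ψ z ^ 2 * lineDeriv ℝ b z v) =
      ∫ z, ψ z ^ 2 * b z * inner ℝ v (outerNormal Ω z) ∂(boundaryMeasure Ω) := by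
  rw [← integral_mul_boundary hΩ (hψ.pow 2) hb v]
  congr 1 with z
  have h := ((hψ.differentiable (by simp)) z).hasFDerivAt.pow 2
  rw [h.fderiv, inner_gradient_left]
  simp

lemma IsChart.ae_one_le_mul_inner_outerNormal {U : Set Plane} {e : Plane ≃ᵃⁱ[ℝ] Plane}
    {f : ℝ → ℝ} {K : ℝ≥0} (h : IsChart Ω U e f K) :
    ∀ᵐ z ∂((boundaryMeasure Ω).restrict U),
      1 ≤ (1 + K) * inner ℝ (e.linearIsometryEquiv.symm !₂[0, -1]) (outerNormal Ω z) := by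
  rw [h.ae_restrict_iff]
  filter_upwards [h.lipschitz.ae_differentiableAt_real] with s hd hs
  have hinner : inner ℝ (e.linearIsometryEquiv.symm !₂[0, -1]) (chartNormal e f s) =
      (arcDensity f s)⁻¹ := by
    simp [inner_chartNormal]
  rw [h.outerNormal_eq hs hd, hinner, ← div_eq_mul_inv, one_le_div (arcDensity_pos f s)]
  exact arcDensity_le h.lipschitz

lemma abs_two_mul_mul_add_sq_mul_le {a d γ x l M B : ℝ} (hd : |d| ≤ γ) (hx : |x| ≤ M)
    (hl : |l| ≤ B) : |2 * a * d * x + a ^ 2 * l| ≤ (M + B) * (a ^ 2 + γ ^ 2) := by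
  have hγ : 0 ≤ γ := (abs_nonneg d).trans hd
  have hM : 0 ≤ M := (abs_nonneg x).trans hx
  have hB : 0 ≤ B := (abs_nonneg l).trans hl
  calc |2 * a * d * x + a ^ 2 * l|
      ≤ 2 * |a| * |d| * |x| + a ^ 2 * |l| := by
        refine (abs_add_le _ _).trans_eq ?_
        simp only [abs_mul, abs_two, abs_pow, sq_abs]
    _ ≤ 2 * |a| * γ * M + a ^ 2 * B := by gcongr
    _ ≤ (a ^ 2 + γ ^ 2) * M + (a ^ 2 + γ ^ 2) * B := by
        gcongr
        · nlinarith [sq_nonneg (|a| - γ), sq_abs a]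
        · exact le_add_of_nonneg_right (sq_nonneg γ)
    _ = (M + B) * (a ^ 2 + γ ^ 2) := by ring

lemma integrableOn_sq_add_norm_gradient_sq (hΩ : Bornology.IsBounded Ω) {ψ : Plane → ℝ}
    (hψ : ContDiff ℝ ∞ ψ) : IntegrableOn (fun z => ψ z ^ 2 + ‖gradient ψ z‖ ^ 2) Ω :=
  memLp_one_iff_integrable.1 (memLp_restrict_of_continuous hΩ
    ((hψ.continuous.pow 2).add ((continuous_gradient hψ).norm.pow 2)) 1)

lemma IsChart.exists_trace_bound (hΩ : IsBoundedLipschitz Ω) {U : Set Plane}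
    {e : Plane ≃ᵃⁱ[ℝ] Plane} {f : ℝ → ℝ} {K : ℝ≥0} (h : IsChart Ω U e f K) {ζ : Plane → ℝ}
    (hζ : IsTest U ζ) (hζ0 : ∀ p, 0 ≤ ζ p) :
    ∃ C : ℝ, ∀ ψ : Plane → ℝ, ContDiff ℝ ∞ ψ →
      ∫ z, ζ z * ψ z ^ 2 ∂(boundaryMeasure Ω) ≤ C * ∫ z in Ω, (ψ z ^ 2 + ‖gradient ψ z‖ ^ 2) := by
  obtain ⟨B, hB⟩ := hζ.exists_lipschitzWith
  obtain ⟨M, hM⟩ := hζ.2.1.exists_bound_of_continuous hζ.1.continuous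
  set v : Plane := e.linearIsometryEquiv.symm !₂[0, -1] with hv
  have hv1 : ‖v‖ = 1 := by simp [hv, EuclideanSpace.norm_eq]
  refine ⟨(1 + K) * (M + B), fun ψ hψ => ?_⟩
  have hpos : ∀ᵐ z ∂(boundaryMeasure Ω),
      ζ z * ψ z ^ 2 ≤ (1 + K) * (ψ z ^ 2 * ζ z * inner ℝ v (outerNormal Ω z)) := by
    filter_upwards [(MeasureTheory.ae_restrict_iff' h.isOpen.measurableSet).1
      h.ae_one_le_mul_inner_outerNormal] with z hz
    by_cases hzU : z ∈ U
    · linarith [mul_le_mul_of_nonneg_left (hz hzU) (mul_nonneg (sq_nonneg (ψ z)) (hζ0 z))]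
    · simp [image_eq_zero_of_notMem_tsupport fun hz' => hzU (hζ.2.2 hz')]
  have hbound (z : Plane) :
      |2 * ψ z * inner ℝ (gradient ψ z) v * ζ z + ψ z ^ 2 * lineDeriv ℝ ζ z v| ≤
        (M + B) * (ψ z ^ 2 + ‖gradient ψ z‖ ^ 2) := by
    refine abs_two_mul_mul_add_sq_mul_le ?_ (hM z) ?_
    · simpa [hv1] using abs_real_inner_le_norm (gradient ψ z) v
    · simpa [hv1] using norm_lineDeriv_le_of_lipschitz ℝ (x₀ := z) (v := v) hB
  calc ∫ z, ζ z * ψ z ^ 2 ∂(boundaryMeasure Ω)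
      ≤ ∫ z, (1 + K) * (ψ z ^ 2 * ζ z * inner ℝ v (outerNormal Ω z)) ∂(boundaryMeasure Ω) :=
        integral_mono_of_nonneg (.of_forall fun z => mul_nonneg (hζ0 z) (sq_nonneg _))
          ((integrable_mul_inner_outerNormal hΩ
            ((hψ.continuous.pow 2).mul hζ.1.continuous) v).const_mul _) hpos
    _ = (1 + K) * ∫ z in Ω, (2 * ψ z * inner ℝ (gradient ψ z) v * ζ z
          + ψ z ^ 2 * lineDeriv ℝ ζ z v) := by
        rw [integral_const_mul, integral_sq_mul_boundary hΩ hψ hB v]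
    _ ≤ (1 + K) * ∫ z in Ω, (M + B) * (ψ z ^ 2 + ‖gradient ψ z‖ ^ 2) := by
        refine mul_le_mul_of_nonneg_left ?_ (by positivity)
        refine (le_abs_self _).trans (abs_integral_le_integral_abs.trans ?_)
        exact integral_mono_of_nonneg (.of_forall fun z => abs_nonneg _)
          ((integrableOn_sq_add_norm_gradient_sq hΩ.isBounded hψ).const_mul _)
          (.of_forall hbound)
    _ = (1 + K) * (M + B) * ∫ z in Ω, (ψ z ^ 2 + ‖gradient ψ z‖ ^ 2) := by
        rw [integral_const_mul, mul_assoc]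

theorem exists_trace_bound (hΩ : IsBoundedLipschitz Ω) :
    ∃ C : ℝ, ∀ ψ : Plane → ℝ, ContDiff ℝ ∞ ψ →
      ∫ z, ψ z ^ 2 ∂(boundaryMeasure Ω) ≤ C * ∫ z in Ω, (ψ z ^ 2 + ‖gradient ψ z‖ ^ 2) := by
  have hchart : ∀ z ∈ frontier Ω, ∃ U, IsOpen U ∧ z ∈ U ∧ ∃ e f K, IsChart Ω U e f K :=
    fun z hz => by
      obtain ⟨U, e, f, K, hzU, h⟩ := hΩ.exists_chart hz
      exact ⟨U, h.isOpen, hzU, e, f, K, h⟩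
  obtain ⟨ι, _, ζ, hζ, hsum⟩ := exists_smooth_partition (isCompact_frontier hΩ) hchart
  choose hζ0 U _ hU hζU using hζ
  choose e f K h using hU
  choose C hC using fun i => (h i).exists_trace_bound hΩ (hζU i) (hζ0 i)
  refine ⟨∑ i, C i, fun ψ hψ => ?_⟩
  have hint (i : ι) : Integrable (fun z => ζ i z * ψ z ^ 2) (boundaryMeasure Ω) :=
    memLp_one_iff_integrable.1 (memLp_boundary_of_continuousOn hΩ
      ((hζU i).1.continuous.mul (hψ.continuous.pow 2)).continuousOn 1)
  calc ∫ z, ψ z ^ 2 ∂(boundaryMeasure Ω)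
      = ∫ z, ∑ i, ζ i z * ψ z ^ 2 ∂(boundaryMeasure Ω) := by
        refine setIntegral_congr_fun isClosed_frontier.measurableSet fun z hz => ?_
        simp only [← Finset.sum_mul, hsum z hz, one_mul]
    _ = ∑ i, ∫ z, ζ i z * ψ z ^ 2 ∂(boundaryMeasure Ω) := integral_finsetSum _ fun i _ => hint i
    _ ≤ ∑ i, C i * ∫ z in Ω, (ψ z ^ 2 + ‖gradient ψ z‖ ^ 2) :=
        Finset.sum_le_sum fun i _ => hC i ψ hψ
    _ = (∑ i, C i) * ∫ z in Ω, (ψ z ^ 2 + ‖gradient ψ z‖ ^ 2) := (Finset.sum_mul ..).symm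

end TraceInequality

section Mollification

open ContinuousLinearMap
open scoped Convolution

variable {V E : Type*} [NormedAddCommGroup V] [NormedSpace ℝ V] [FiniteDimensional ℝ V]
  [MeasurableSpace V] [BorelSpace V] {μ : Measure V} [μ.IsAddHaarMeasure] [NormedAddCommGroup E]
  {F : V → E}

lemma tendsto_eLpNorm_translate {p : ℝ≥0∞} [Fact (1 ≤ p)] (hp : p ≠ ⊤) (hF : MemLp F p μ) :
    Tendsto (fun q => eLpNorm (fun z => F (z - q) - F z) p μ) (𝓝 0) (𝓝 0) := by
  have : Fact (p ≠ ⊤) := ⟨hp⟩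
  have hcont : Continuous fun q : V => (DomAddAct.mk (-q) +ᵥ hF.toLp F : Lp E p μ) :=
    (DomAddAct.continuous_mk.comp continuous_neg).vadd continuous_const
  have hlim := hcont.tendsto 0
  rw [neg_zero, DomAddAct.mk_zero, zero_vadd, tendsto_iff_edist_tendsto_0] at hlim
  refine hlim.congr fun q => ?_
  rw [DomAddAct.mk_vadd_toLp, Lp.edist_toLp_toLp]
  congr 1 with z
  simp [sub_eq_add_neg, add_comm]

variable [NormedSpace ℝ E]

lemma enorm_integral_rpow_le {α : Type*} [MeasurableSpace α] {P : Measure α}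
    [IsProbabilityMeasure P] {f : α → E} (hf : AEStronglyMeasurable f P) {p : ℝ≥0} (hp : 1 ≤ p) :
    ‖∫ a, f a ∂P‖ₑ ^ (p : ℝ) ≤ ∫⁻ a, ‖f a‖ₑ ^ (p : ℝ) ∂P := by
  rw [← eLpNorm_nnreal_pow_eq_lintegral (zero_lt_one.trans_le hp).ne']
  gcongr
  calc ‖∫ a, f a ∂P‖ₑ ≤ eLpNorm f 1 P := by
        rw [eLpNorm_one_eq_lintegral_enorm]
        exact enorm_integral_le_lintegral_enorm f
    _ ≤ eLpNorm f p P := eLpNorm_le_eLpNorm_of_exponent_le (by exact_mod_cast hp) hf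

lemma fderiv_normed_convolution {c : V} (B : ContDiffBump c) (hF : LocallyIntegrable F μ)
    (z v : V) :
    fderiv ℝ (B.normed μ ⋆[lsmul ℝ ℝ, μ] F) z v =
      ∫ q, fderiv ℝ (B.normed μ) (z - q) v • F q ∂μ := by
  have hρ : ContDiff ℝ 1 (B.normed μ) := B.contDiff_normed
  have hint := (B.hasCompactSupport_normed (μ := μ)).fderiv (𝕜 := ℝ)
    |>.convolutionExists_left ((lsmul ℝ ℝ : ℝ →L[ℝ] E →L[ℝ] E).precompL V)
      (hρ.continuous_fderiv one_ne_zero) hF z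
  rw [(B.hasCompactSupport_normed.hasFDerivAt_convolution_left _ hρ hF z).fderiv,
    convolution_def, ContinuousLinearMap.integral_apply hint,
    ← integral_sub_left_eq_self _ μ z]
  simp

variable [CompleteSpace E]

lemma eLpNorm_average_translate_sub_le (hF : StronglyMeasurable F) {P : Measure V}
    [IsProbabilityMeasure P] (hint : ∀ z, Integrable (fun q => F (z - q)) P) {p : ℝ≥0}
    (hp : 1 ≤ p) {ε : ℝ≥0∞} (hε : ∀ᵐ q ∂P, eLpNorm (fun z => F (z - q) - F z) p μ ≤ ε) :
    eLpNorm (fun z => (∫ q, F (z - q) ∂P) - F z) p μ ≤ ε := by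
  have hp0 : 0 < p := zero_lt_one.trans_le hp
  have hmeas : Measurable fun a : V × V => ‖F (a.1 - a.2) - F a.1‖ₑ ^ (p : ℝ) :=
    ((hF.comp_measurable (measurable_fst.sub measurable_snd)).sub
      (hF.comp_measurable measurable_fst)).enorm.pow_const _
  rw [← ENNReal.rpow_le_rpow_iff (z := p) (by exact_mod_cast hp0),
    eLpNorm_nnreal_pow_eq_lintegral hp0.ne']
  calc ∫⁻ z, ‖(∫ q, F (z - q) ∂P) - F z‖ₑ ^ (p : ℝ) ∂μ
      = ∫⁻ z, ‖∫ q, (F (z - q) - F z) ∂P‖ₑ ^ (p : ℝ) ∂μ := by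
        simp only [integral_sub (hint _) (integrable_const _), integral_const, probReal_univ,
          one_smul]
    _ ≤ ∫⁻ z, ∫⁻ q, ‖F (z - q) - F z‖ₑ ^ (p : ℝ) ∂P ∂μ := lintegral_mono fun z =>
        enorm_integral_rpow_le ((hint z).aestronglyMeasurable.sub aestronglyMeasurable_const) hp
    _ = ∫⁻ q, (∫⁻ z, ‖F (z - q) - F z‖ₑ ^ (p : ℝ) ∂μ) ∂P :=
        lintegral_lintegral_swap hmeas.aemeasurable
    _ ≤ ∫⁻ _, ε ^ (p : ℝ) ∂P := by
        refine lintegral_mono_ae (hε.mono fun q hq => ?_)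
        rw [← eLpNorm_nnreal_pow_eq_lintegral hp0.ne']
        gcongr
    _ = ε ^ (p : ℝ) := by simp

variable {c : V} (B : ContDiffBump c)

lemma isProbabilityMeasure_withDensity_normed :
    IsProbabilityMeasure (μ.withDensity fun q => ENNReal.ofReal (B.normed μ q)) := by
  refine ⟨?_⟩
  rw [withDensity_apply _ .univ, Measure.restrict_univ,
    ← ofReal_integral_eq_lintegral_ofReal B.integrable_normed (.of_forall B.nonneg_normed),
    B.integral_normed, ENNReal.ofReal_one]

lemma eLpNorm_normed_convolution_sub_le (hF : StronglyMeasurable F) (hFi : LocallyIntegrable F μ)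
    {p : ℝ≥0} (hp : 1 ≤ p) {ε : ℝ≥0∞}
    (hε : ∀ q ∈ Metric.ball c B.rOut, eLpNorm (fun z => F (z - q) - F z) p μ ≤ ε) :
    eLpNorm (fun z => (B.normed μ ⋆[lsmul ℝ ℝ, μ] F) z - F z) p μ ≤ ε := by
  have hρ : Measurable fun q => ENNReal.ofReal (B.normed μ q) :=
    B.continuous_normed.measurable.ennreal_ofReal
  have hρ_top : ∀ᵐ q ∂μ, ENNReal.ofReal (B.normed μ q) < ⊤ :=
    .of_forall fun _ => ENNReal.ofReal_lt_top
  have := isProbabilityMeasure_withDensity_normed (μ := μ) B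
  have hint (z : V) : Integrable (fun q => F (z - q))
      (μ.withDensity fun q => ENNReal.ofReal (B.normed μ q)) := by
    rw [integrable_withDensity_iff_integrable_smul' hρ hρ_top]
    simp only [ENNReal.toReal_ofReal (B.nonneg_normed _)]
    exact B.hasCompactSupport_normed.convolutionExists_left (lsmul ℝ ℝ) B.continuous_normed hFi z
  have heq (z : V) : (B.normed μ ⋆[lsmul ℝ ℝ, μ] F) z =
      ∫ q, F (z - q) ∂μ.withDensity fun q => ENNReal.ofReal (B.normed μ q) := by
    simp only [integral_withDensity_eq_integral_toReal_smul hρ hρ_top,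
      ENNReal.toReal_ofReal (B.nonneg_normed _), convolution_def, lsmul_apply]
  simp only [heq]
  refine eLpNorm_average_translate_sub_le hF hint hp ((ae_withDensity_iff hρ).2 ?_)
  refine .of_forall fun q hq => hε q ?_
  rw [← B.support_normed_eq (μ := μ)]
  exact fun h0 => hq (by rw [h0, ENNReal.ofReal_zero])

lemma tendsto_eLpNorm_normed_convolution_sub {p : ℝ≥0} (hp : 1 ≤ p) (hF : MemLp F p μ)
    {ι : Type*} {l : Filter ι} {c : ι → V} (B : ∀ i, ContDiffBump (c i))
    (hc : Tendsto c l (𝓝 0)) (hB : Tendsto (fun i => (B i).rOut) l (𝓝 0)) :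
    Tendsto (fun i => eLpNorm (fun z => ((B i).normed μ ⋆[lsmul ℝ ℝ, μ] F) z - F z) p μ)
      l (𝓝 0) := by
  have hp' : (1 : ℝ≥0∞) ≤ p := by exact_mod_cast hp
  have : Fact ((1 : ℝ≥0∞) ≤ p) := ⟨hp'⟩
  obtain ⟨G, hGm, hFG⟩ := hF.aestronglyMeasurable
  have hG : MemLp G p μ := hF.ae_eq hFG
  have heq (i : ι) : eLpNorm (fun z => ((B i).normed μ ⋆[lsmul ℝ ℝ, μ] F) z - F z) p μ =
      eLpNorm (fun z => ((B i).normed μ ⋆[lsmul ℝ ℝ, μ] G) z - G z) p μ := by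
    rw [convolution_congr _ .rfl hFG]
    exact eLpNorm_congr_ae (hFG.mono fun z hz => congrArg _ hz)
  simp only [heq]
  refine ENNReal.tendsto_nhds_zero.2 fun ε hε => ?_
  obtain ⟨r, hr, hball⟩ := Metric.eventually_nhds_iff.1 (ENNReal.tendsto_nhds_zero.1
    (tendsto_eLpNorm_translate ENNReal.coe_ne_top hG) ε hε)
  have hlim : Tendsto (fun i => ‖c i‖ + (B i).rOut) l (𝓝 0) := by simpa using hc.norm.add hB
  filter_upwards [hlim.eventually_lt_const hr] with i hi
  refine eLpNorm_normed_convolution_sub_le (B i) hGm (hG.locallyIntegrable hp') hp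
    fun q hq => hball ?_
  have hq' : dist q (c i) < (B i).rOut := hq
  calc dist q 0 ≤ dist q (c i) + dist (c i) 0 := dist_triangle _ _ _
    _ < r := by
      rw [dist_zero_right]
      linarith

end Mollification

section InteriorCone

variable {U : Set Plane} {ν : Plane} {δ : ℝ}

/-- The uniform interior cone property of `Ω` in `U`: the cone around the direction `ν` of opening
`δ` with vertex at a point of `Ω ∩ U` stays in `Ω` as long as it stays in `U`. -/
def HasInteriorCone (Ω U : Set Plane) (ν : Plane) (δ : ℝ) : Prop :=
  0 < δ ∧ ∀ p ∈ U, p ∈ Ω → ∀ q ∈ U, ∀ t : ℝ, 0 < t → ‖q - p - t • ν‖ ≤ δ * t → q ∈ Ω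

lemma IsChart.hasInteriorCone {e : Plane ≃ᵃⁱ[ℝ] Plane} {f : ℝ → ℝ} {K : ℝ≥0}
    (h : IsChart Ω U e f K) :
    HasInteriorCone Ω U (e.linearIsometryEquiv.symm !₂[0, 1]) (2 + (K : ℝ))⁻¹ := by
  have hK : (0 : ℝ) ≤ K := K.2
  refine ⟨by positivity, fun p hpU hp q hqU t ht hq => ?_⟩
  rw [h.mem_iff p hpU] at hp
  rw [h.mem_iff q hqU]
  set w : Plane := e.linearIsometryEquiv (q - p - t • e.linearIsometryEquiv.symm !₂[0, 1])
    with hw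
  have hwe : w = e q - e p - t • !₂[0, 1] := by
    rw [hw, map_sub, map_smul, LinearIsometryEquiv.apply_symm_apply]
    exact congrArg (· - _) (e.map_vsub q p)
  have hcoord (i) : ‖w i‖ ≤ (2 + (K : ℝ))⁻¹ * t :=
    (PiLp.norm_apply_le w i).trans (by rwa [hw, LinearIsometryEquiv.norm_map])
  have h0 : |e q 0 - e p 0| ≤ (2 + (K : ℝ))⁻¹ * t := by simpa [hwe] using hcoord 0
  have h1 : |e q 1 - e p 1 - t| ≤ (2 + (K : ℝ))⁻¹ * t := by simpa [hwe] using hcoord 1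
  have hf : |f (e q 0) - f (e p 0)| ≤ K * ((2 + (K : ℝ))⁻¹ * t) :=
    (h.lipschitz.dist_le_mul (e q 0) (e p 0)).trans (mul_le_mul_of_nonneg_left h0 hK)
  have ht_eq : (2 + (K : ℝ))⁻¹ * t * (2 + K) = t := by field_simp
  have ht_pos : 0 < (2 + (K : ℝ))⁻¹ * t := by positivity
  linarith [(abs_le.1 hf).2, (abs_le.1 h1).1]

lemma IsBoundedLipschitz.exists_hasInteriorCone (hΩ : IsBoundedLipschitz Ω) {z : Plane}
    (hz : z ∈ closure Ω) : ∃ U, IsOpen U ∧ z ∈ U ∧ ∃ ν δ, HasInteriorCone Ω U ν δ := by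
  by_cases hzΩ : z ∈ Ω
  · exact ⟨Ω, hΩ.isOpen, hzΩ, 0, 1, one_pos, fun _ _ _ q hq _ _ _ => hq⟩
  · obtain ⟨U, e, f, K, hzU, h⟩ :=
      hΩ.exists_chart (by rw [hΩ.isOpen.frontier_eq]; exact ⟨hz, hzΩ⟩)
    exact ⟨U, h.isOpen, hzU, _, _, h.hasInteriorCone⟩

lemma HasInteriorCone.isTest_mul_normed_sub (h : HasInteriorCone Ω U ν δ) {ζ : Plane → ℝ}
    (hζ : IsTest U ζ) {τ : ℝ} (hτ : 0 < τ)
    (hU : Metric.cthickening (τ * (‖ν‖ + δ)) (tsupport ζ) ⊆ U) (B : ContDiffBump (-(τ • ν)))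
    (hB : B.rOut ≤ δ * τ) {p : Plane} (hp : p ∈ Ω) :
    IsTest Ω fun z => ζ z * B.normed volume (p - z) := by
  refine ⟨hζ.1.mul (B.contDiff_normed.comp (contDiff_const.sub contDiff_id)), hζ.2.1.mul_right,
    fun z hz => ?_⟩
  have hzζ : z ∈ tsupport ζ := tsupport_mul_subset_left hz
  have hzB : p - z ∈ tsupport (B.normed volume) :=
    tsupport_comp_subset_preimage (B.normed volume) (f := fun z => p - z) (by fun_prop)
      (tsupport_mul_subset_right hz)
  have hcone : ‖p - z + τ • ν‖ ≤ δ * τ := by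
    rw [B.tsupport_normed_eq, Metric.mem_closedBall, dist_eq_norm, sub_neg_eq_add] at hzB
    exact hzB.trans hB
  have hdist : dist p z ≤ τ * (‖ν‖ + δ) := by
    calc dist p z = ‖(p - z + τ • ν) - τ • ν‖ := by rw [dist_eq_norm]; congr 1; abel
      _ ≤ ‖p - z + τ • ν‖ + ‖τ • ν‖ := norm_sub_le _ _
      _ ≤ τ * (‖ν‖ + δ) := by rw [norm_smul, Real.norm_of_nonneg hτ.le]; linarith
  refine h.2 p (hU (Metric.mem_cthickening_of_dist_le p z _ _ hzζ hdist)) hp z (hζ.2.2 hzζ) τ hτ ?_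
  rwa [← norm_neg, show -(z - p - τ • ν) = p - z + τ • ν by abel]

end InteriorCone

section ProductRule

open ContinuousLinearMap
open scoped Convolution

variable {x ζ ρ : Plane → ℝ} {G : Plane → Plane}

lemma IsWeakGrad.integral_mul_fderiv (hxG : IsWeakGrad Ω x G)
    (hx : LocallyIntegrable x (volume.restrict Ω)) (hG : LocallyIntegrable G (volume.restrict Ω))
    (hζ : ContDiff ℝ ∞ ζ) (hζc : HasCompactSupport ζ) (hρ : ContDiff ℝ ∞ ρ)
    (hζρ : IsTest Ω fun z => ζ z * ρ z) (v : Plane) :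
    ∫ z in Ω, fderiv ℝ ρ z v * (ζ z * x z) =
      -∫ z in Ω, ρ z * inner ℝ (x z • gradient ζ z + ζ z • G z) v := by
  have hdζ : Continuous fun z => fderiv ℝ ζ z v :=
    (hζ.continuous_fderiv (by simp)).clm_apply continuous_const
  have hdρ : Continuous fun z => fderiv ℝ ρ z v :=
    (hρ.continuous_fderiv (by simp)).clm_apply continuous_const
  have hi₁ : IntegrableOn (fun z => (ζ z * fderiv ℝ ρ z v) * x z) Ω :=
    hx.integrable_smul_left_of_hasCompactSupport (hζ.continuous.mul hdρ) hζc.mul_right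
  have hi₂ : IntegrableOn (fun z => (fderiv ℝ ζ z v * ρ z) * x z) Ω :=
    hx.integrable_smul_left_of_hasCompactSupport (hdζ.mul hρ.continuous)
      (hζc.fderiv_apply (𝕜 := ℝ) v).mul_right
  have hi₃ : IntegrableOn (fun z => inner ℝ (G z) v * (ζ z * ρ z)) Ω :=
    ((hG.integrable_smul_left_of_hasCompactSupport (hζ.continuous.mul hρ.continuous)
      hζc.mul_right).inner_const v).congr
      (.of_forall fun z => by simp only [real_inner_smul_left, Pi.mul_apply, mul_comm])
  have hfderiv (z) : x z * fderiv ℝ (fun z => ζ z * ρ z) z v =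
      ζ z * fderiv ℝ ρ z v * x z + fderiv ℝ ζ z v * ρ z * x z := by
    rw [fderiv_fun_mul (hζ.differentiable (by simp) z) (hρ.differentiable (by simp) z)]
    simp only [add_apply, smul_apply, smul_eq_mul]
    ring
  have hweak := hxG.2.2 _ hζρ v
  simp only [hfderiv] at hweak
  rw [integral_add hi₁ hi₂, ← eq_sub_iff_add_eq, ← neg_add', ← integral_add hi₃ hi₂] at hweak
  calc ∫ z in Ω, fderiv ℝ ρ z v * (ζ z * x z) = ∫ z in Ω, ζ z * fderiv ℝ ρ z v * x z := by
        congr 1 with z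
        ring
    _ = _ := hweak
    _ = -∫ z in Ω, ρ z * inner ℝ (x z • gradient ζ z + ζ z • G z) v := by
        congr 2 with z
        rw [inner_add_left, real_inner_smul_left, real_inner_smul_left, inner_gradient_left]
        ring

lemma hasCompactSupport_gradient (hζ : HasCompactSupport ζ) : HasCompactSupport (gradient ζ) :=
  (hζ.fderiv (𝕜 := ℝ)).comp_left (map_zero _)

lemma IsWeakGrad.gradient_normed_convolution (hxG : IsWeakGrad Ω x G)
    (hx : LocallyIntegrable x (volume.restrict Ω)) (hG : LocallyIntegrable G (volume.restrict Ω))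
    (hΩ : MeasurableSet Ω) (hζ : ContDiff ℝ ∞ ζ) (hζc : HasCompactSupport ζ) {c : Plane}
    (B : ContDiffBump c) {p : Plane} (hp : IsTest Ω fun z => ζ z * B.normed volume (p - z)) :
    gradient (B.normed volume ⋆[lsmul ℝ ℝ, volume] Ω.indicator fun z => ζ z * x z) p =
      (B.normed volume ⋆[lsmul ℝ ℝ, volume]
        Ω.indicator fun z => x z • gradient ζ z + ζ z • G z) p := by
  have hρ : ContDiff ℝ ∞ fun z => B.normed volume (p - z) :=
    B.contDiff_normed.comp (contDiff_const.sub contDiff_id)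
  have hρc : HasCompactSupport fun z => B.normed volume (p - z) :=
    (B.hasCompactSupport_normed (μ := volume)).comp_homeomorph (Homeomorph.subLeft p)
  have hfderiv (v z) : fderiv ℝ (fun z => B.normed volume (p - z)) z v =
      -fderiv ℝ (B.normed volume) (p - z) v := by
    have h := ((B.contDiff_normed (n := 1) (μ := volume)).differentiable one_ne_zero
      (p - z)).hasFDerivAt.comp z ((hasFDerivAt_id z).const_sub p)
    exact (DFunLike.congr_fun h.fderiv v).trans (by simp)
  have hF : IntegrableOn (fun z => ζ z * x z) Ω :=
    hx.integrable_smul_left_of_hasCompactSupport hζ.continuous hζc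
  have hH : IntegrableOn (fun z => x z • gradient ζ z + ζ z • G z) Ω :=
    (hx.integrable_smul_right_of_hasCompactSupport (continuous_gradient hζ)
      (hasCompactSupport_gradient hζc)).add
      (hG.integrable_smul_left_of_hasCompactSupport hζ.continuous hζc)
  refine ext_inner_right ℝ fun v => ?_
  calc inner ℝ (gradient (B.normed volume ⋆[lsmul ℝ ℝ, volume]
        Ω.indicator fun z => ζ z * x z) p) v
      = ∫ z in Ω, fderiv ℝ (B.normed volume) (p - z) v * (ζ z * x z) := by
        rw [inner_gradient_left, fderiv_normed_convolution B (hF.integrable_indicator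
          hΩ).locallyIntegrable, ← integral_indicator hΩ]
        congr 1 with q
        exact (indicator_smul_apply Ω (fun q => fderiv ℝ (B.normed volume) (p - q) v) _ q).symm
    _ = ∫ z in Ω, inner ℝ v (B.normed volume (p - z) • (x z • gradient ζ z + ζ z • G z)) := by
        have h := hxG.integral_mul_fderiv hx hG hζ hζc hρ hp v
        simpa only [hfderiv, neg_mul, integral_neg, neg_inj, real_inner_comm,
          real_inner_smul_right] using h
    _ = _ := by
        rw [integral_inner (hH.locallyIntegrable.integrable_smul_left_of_hasCompactSupport
          hρ.continuous hρc), real_inner_comm, convolution_lsmul_swap, ← integral_indicator hΩ]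
        simp only [indicator_smul_apply]

end ProductRule

section Gradient

variable {𝕜 V : Type*} [RCLike 𝕜] [NormedAddCommGroup V] [InnerProductSpace 𝕜 V] [CompleteSpace V]

lemma gradient_sub {f g : V → 𝕜} {z : V} (hf : DifferentiableAt 𝕜 f z)
    (hg : DifferentiableAt 𝕜 g z) :
    gradient (fun p => f p - g p) z = gradient f z - gradient g z := by
  simp only [gradient, fderiv_fun_sub hf hg, map_sub]

lemma gradient_sum {ι : Type*} {t : Finset ι} {f : ι → V → 𝕜} {z : V}
    (h : ∀ i ∈ t, DifferentiableAt 𝕜 (f i) z) :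
    gradient (fun p => ∑ i ∈ t, f i p) z = ∑ i ∈ t, gradient (f i) z := by
  simp only [gradient, fderiv_fun_sum h, map_sum]

end Gradient

lemma tendsto_eLpNorm_sum {α β ι E : Type*} [MeasurableSpace α] [NormedAddCommGroup E]
    {μ : Measure α} {p : ℝ≥0∞} (hp : 1 ≤ p) {l : Filter β} {t : Finset ι} {f : ι → β → α → E}
    (hm : ∀ i ∈ t, ∀ k, AEStronglyMeasurable (f i k) μ)
    (h : ∀ i ∈ t, Tendsto (fun k => eLpNorm (f i k) p μ) l (𝓝 0)) :
    Tendsto (fun k => eLpNorm (∑ i ∈ t, f i k) p μ) l (𝓝 0) :=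
  tendsto_of_tendsto_of_tendsto_of_le_of_le tendsto_const_nhds
    (by simpa only [Finset.sum_const_zero] using tendsto_finsetSum t h) (fun _ => zero_le)
    fun k => eLpNorm_sum_le (fun i hi => hm i hi k) hp

section SmoothApproximation

/-- The sequence `ψ` of functions that are smooth up to the boundary converges in `H¹(Ω)` to the
function `x` with weak gradient `G`. -/
structure ApproximatesH1 (Ω : Set Plane) (ψ : ℕ → Plane → ℝ) (x : Plane → ℝ)
    (G : Plane → Plane) : Prop where
  memLp : MemLp x 2 (volume.restrict Ω)
  memLp_grad : MemLp G 2 (volume.restrict Ω)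
  contDiff : ∀ k, ContDiff ℝ ∞ (ψ k)
  tendsto : Tendsto (fun k => eLpNorm (fun z => ψ k z - x z) 2 (volume.restrict Ω)) atTop (𝓝 0)
  tendsto_grad : Tendsto (fun k => eLpNorm (fun z => gradient (ψ k) z - G z) 2
    (volume.restrict Ω)) atTop (𝓝 0)

variable {x : Plane → ℝ} {G : Plane → Plane}

lemma ApproximatesH1.sum {ι : Type*} {t : Finset ι} {ψ : ι → ℕ → Plane → ℝ} {y : ι → Plane → ℝ}
    {H : ι → Plane → Plane} (h : ∀ i ∈ t, ApproximatesH1 Ω (ψ i) (y i) (H i)) :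
    ApproximatesH1 Ω (fun k z => ∑ i ∈ t, ψ i k z) (fun z => ∑ i ∈ t, y i z)
      (fun z => ∑ i ∈ t, H i z) where
  memLp := memLp_finsetSum t fun i hi => (h i hi).memLp
  memLp_grad := memLp_finsetSum t fun i hi => (h i hi).memLp_grad
  contDiff k := ContDiff.sum fun i hi => (h i hi).contDiff k
  tendsto := by
    refine (tendsto_eLpNorm_sum one_le_two (fun i hi k =>
      ((h i hi).contDiff k).continuous.aestronglyMeasurable.sub (h i hi).memLp.1)
      fun i hi => (h i hi).tendsto).congr fun k => congrArg (eLpNorm · 2 _) ?_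
    funext z
    simp only [Finset.sum_apply, Pi.sub_apply, Finset.sum_sub_distrib]
  tendsto_grad := by
    refine (tendsto_eLpNorm_sum one_le_two (fun i hi k =>
      (continuous_gradient ((h i hi).contDiff k)).aestronglyMeasurable.sub (h i hi).memLp_grad.1)
      fun i hi => (h i hi).tendsto_grad).congr fun k => congrArg (eLpNorm · 2 _) ?_
    funext z
    rw [gradient_sum fun i hi => ((h i hi).contDiff k).differentiable (by simp) z]
    simp only [Finset.sum_apply, Pi.sub_apply, Finset.sum_sub_distrib]

lemma ApproximatesH1.congr {ψ : ℕ → Plane → ℝ} {y : Plane → ℝ} {H : Plane → Plane}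
    (h : ApproximatesH1 Ω ψ x G) (hxy : x =ᵐ[volume.restrict Ω] y)
    (hGH : G =ᵐ[volume.restrict Ω] H) : ApproximatesH1 Ω ψ y H where
  memLp := h.memLp.ae_eq hxy
  memLp_grad := h.memLp_grad.ae_eq hGH
  contDiff := h.contDiff
  tendsto := h.tendsto.congr fun k => eLpNorm_congr_ae (hxy.mono fun z hz => by simp only [hz])
  tendsto_grad :=
    h.tendsto_grad.congr fun k => eLpNorm_congr_ae (hGH.mono fun z hz => by simp only [hz])

lemma tendsto_eLpNorm_sub_restrict {α β E : Type*} [MeasurableSpace α] [NormedAddCommGroup E]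
    {μ : Measure α} {p : ℝ≥0∞} {l : Filter β} {s : Set α} (hs : MeasurableSet s)
    {f : β → α → E} {g : α → E}
    (h : Tendsto (fun k => eLpNorm (fun a => f k a - s.indicator g a) p μ) l (𝓝 0)) :
    Tendsto (fun k => eLpNorm (fun a => f k a - g a) p (μ.restrict s)) l (𝓝 0) := by
  refine tendsto_of_tendsto_of_tendsto_of_le_of_le tendsto_const_nhds h (fun _ => zero_le)
    fun k => ?_
  calc eLpNorm (fun a => f k a - g a) p (μ.restrict s)
      = eLpNorm (fun a => f k a - s.indicator g a) p (μ.restrict s) :=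
        eLpNorm_congr_ae ((ae_restrict_mem hs).mono fun a ha => by
          simp only [indicator_of_mem ha])
    _ ≤ eLpNorm (fun a => f k a - s.indicator g a) p μ :=
        eLpNorm_mono_measure _ Measure.restrict_le_self

section Convolution

open ContinuousLinearMap
open scoped Convolution

-- The bump functions are centred at `-τ ν`, so that mollifying at a point of `Ω` only samples
-- points of the interior cone, hence of `Ω`.
lemma HasInteriorCone.exists_approximatesH1 {U : Set Plane} {ν : Plane} {δ : ℝ}
    (h : HasInteriorCone Ω U ν δ) (hΩ : MeasurableSet Ω) (hU : IsOpen U)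
    (hx : MemLp x 2 (volume.restrict Ω)) (hG : MemLp G 2 (volume.restrict Ω))
    (hxG : IsWeakGrad Ω x G) {ζ : Plane → ℝ} (hζ : IsTest U ζ) :
    ∃ ψ, ApproximatesH1 Ω ψ (fun z => ζ z * x z) fun z => x z • gradient ζ z + ζ z • G z := by
  have hζ_top : MemLp ζ ⊤ (volume.restrict Ω) :=
    hζ.1.continuous.memLp_top_of_hasCompactSupport hζ.2.1 _
  have hgradζ_top : MemLp (gradient ζ) ⊤ (volume.restrict Ω) :=
    (continuous_gradient hζ.1).memLp_top_of_hasCompactSupport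
      (hasCompactSupport_gradient hζ.2.1) _
  have hF : MemLp (fun z => ζ z * x z) 2 (volume.restrict Ω) := hx.mul hζ_top
  have hH : MemLp (fun z => x z • gradient ζ z + ζ z • G z) 2 (volume.restrict Ω) :=
    (hgradζ_top.smul hx).add (hG.smul hζ_top)
  have hF' := (memLp_indicator_iff_restrict hΩ).2 hF
  have hH' := (memLp_indicator_iff_restrict hΩ).2 hH
  let τ : ℕ → ℝ := fun k => 1 / ((k : ℝ) + 1)
  have hτ (k) : 0 < τ k := Nat.one_div_pos_of_nat
  have hτ_lim : Tendsto τ atTop (𝓝 0) := tendsto_one_div_add_atTop_nhds_zero_nat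
  have hrad_pos (k) : 0 < δ * τ k := mul_pos h.1 (hτ k)
  let B (k : ℕ) : ContDiffBump (-(τ k • ν)) :=
    ⟨δ * τ k / 2, δ * τ k, half_pos (hrad_pos k), half_lt_self (hrad_pos k)⟩
  have hcenter : Tendsto (fun k => -(τ k • ν)) atTop (𝓝 0) := by
    simpa using (hτ_lim.smul_const ν).neg
  have hrad : Tendsto (fun k => (B k).rOut) atTop (𝓝 0) := by simpa using hτ_lim.const_mul δ
  obtain ⟨ε, hε, hthick⟩ := hζ.2.1.exists_cthickening_subset_open hU hζ.2.2
  have hscale : Tendsto (fun k => τ k * (‖ν‖ + δ)) atTop (𝓝 0) := by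
    simpa using hτ_lim.mul_const (‖ν‖ + δ)
  refine ⟨fun k => (B k).normed volume ⋆[lsmul ℝ ℝ, volume] Ω.indicator fun z => ζ z * x z,
    hF, hH, fun k => (B k).hasCompactSupport_normed.contDiff_convolution_left _
      (B k).contDiff_normed (hF'.locallyIntegrable one_le_two),
    tendsto_eLpNorm_sub_restrict hΩ
      (tendsto_eLpNorm_normed_convolution_sub one_le_two hF' B hcenter hrad), ?_⟩
  refine (tendsto_eLpNorm_sub_restrict hΩ
    (tendsto_eLpNorm_normed_convolution_sub one_le_two hH' B hcenter hrad)).congr' ?_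
  filter_upwards [hscale.eventually_lt_const hε] with k hk
  refine eLpNorm_congr_ae ((ae_restrict_mem hΩ).mono fun p hp => congrArg (· - _) ?_)
  exact (hxG.gradient_normed_convolution (hx.locallyIntegrable one_le_two)
    (hG.locallyIntegrable one_le_two) hΩ hζ.1 hζ.2.1 (B k) (h.isTest_mul_normed_sub hζ (hτ k)
      ((Metric.cthickening_mono hk.le _).trans hthick) (B k) le_rfl hp)).symm

end Convolution

theorem IsWeakGrad.exists_approximatesH1 (hΩ : IsBoundedLipschitz Ω) (hxG : IsWeakGrad Ω x G)
    (hx : MemLp x 2 (volume.restrict Ω)) (hG : MemLp G 2 (volume.restrict Ω)) :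
    ∃ ψ, ApproximatesH1 Ω ψ x G := by
  have hΩm := hΩ.isOpen.measurableSet
  obtain ⟨ι, _, ζ, hζ, hsum⟩ := exists_smooth_partition hΩ.isBounded.isCompact_closure
    fun z hz => hΩ.exists_hasInteriorCone hz
  choose _ U hU hcone hζU using hζ
  choose ν δ hcone using hcone
  choose ψ hψ using fun i => (hcone i).exists_approximatesH1 hΩm (hU i) hx hG hxG (hζU i)
  refine ⟨_, (ApproximatesH1.sum (t := Finset.univ) fun i _ => hψ i).congr ?_ ?_⟩
  · filter_upwards [ae_restrict_mem hΩm] with z hz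
    rw [← Finset.sum_mul, hsum z (subset_closure hz), one_mul]
  · filter_upwards [ae_restrict_mem hΩm] with z hz
    have hgrad : ∑ i, gradient (ζ i) z = 0 := by
      have hone : (fun p => ∑ i, ζ i p) =ᶠ[𝓝 z] fun _ => 1 :=
        (hΩ.isOpen.eventually_mem hz).mono fun p hp => hsum p (subset_closure hp)
      rw [← gradient_sum fun i _ => (hζU i).1.differentiable (by simp) z, hone.gradient_eq,
        gradient_fun_const]
    rw [Finset.sum_add_distrib, ← Finset.smul_sum, hgrad, smul_zero, zero_add, ← Finset.sum_smul,
      hsum z (subset_closure hz), one_smul]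

end SmoothApproximation

lemma eLpNorm_two_eq_ofReal_sqrt {α E : Type*} [MeasurableSpace α] [NormedAddCommGroup E]
    {μ : Measure α} {f : α → E} (hf : MemLp f 2 μ) :
    eLpNorm f 2 μ = ENNReal.ofReal √(∫ a, ‖f a‖ ^ 2 ∂μ) := by
  rw [hf.eLpNorm_eq_integral_rpow_norm two_ne_zero ENNReal.ofNat_ne_top, Real.sqrt_eq_rpow]
  norm_num

lemma exists_eLpNorm_boundary_le (hΩ : IsBoundedLipschitz Ω) :
    ∃ C : ℝ≥0, ∀ ψ : Plane → ℝ, ContDiff ℝ ∞ ψ →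
      eLpNorm ψ 2 (boundaryMeasure Ω) ≤
        C * (eLpNorm ψ 2 (volume.restrict Ω) + eLpNorm (gradient ψ) 2 (volume.restrict Ω)) := by
  obtain ⟨C, hC⟩ := exists_trace_bound hΩ
  refine ⟨(√C).toNNReal, fun ψ hψ => ?_⟩
  have hψ_mem := memLp_restrict_of_continuous hΩ.isBounded hψ.continuous 2
  have hgrad_mem := memLp_restrict_of_continuous hΩ.isBounded (continuous_gradient hψ) 2
  rw [eLpNorm_two_eq_ofReal_sqrt hψ_mem, eLpNorm_two_eq_ofReal_sqrt hgrad_mem,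
    eLpNorm_two_eq_ofReal_sqrt (memLp_boundary_of_continuousOn hΩ hψ.continuous.continuousOn 2),
    ← ENNReal.ofReal_add (Real.sqrt_nonneg _) (Real.sqrt_nonneg _), ← ENNReal.ofReal,
    ← ENNReal.ofReal_mul (Real.sqrt_nonneg _)]
  refine ENNReal.ofReal_le_ofReal ?_
  set a := ∫ z in Ω, ‖ψ z‖ ^ 2
  set b := ∫ z in Ω, ‖gradient ψ z‖ ^ 2
  have ha : 0 ≤ a := integral_nonneg fun z => sq_nonneg _
  have hb : 0 ≤ b := integral_nonneg fun z => sq_nonneg _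
  have hbound : ∫ z, ‖ψ z‖ ^ 2 ∂(boundaryMeasure Ω) ≤ C * (a + b) := by
    rw [← integral_add ((memLp_two_iff_integrable_sq_norm hψ_mem.1).1 hψ_mem)
      ((memLp_two_iff_integrable_sq_norm hgrad_mem.1).1 hgrad_mem)]
    simpa only [Real.norm_eq_abs, sq_abs] using hC ψ hψ
  calc √(∫ z, ‖ψ z‖ ^ 2 ∂(boundaryMeasure Ω)) ≤ √(C * (a + b)) := Real.sqrt_le_sqrt hbound
    _ = √C * √(a + b) := Real.sqrt_mul' C (add_nonneg ha hb)
    _ ≤ √C * (√a + √b) := by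
        refine mul_le_mul_of_nonneg_left (Real.sqrt_le_iff.2 ⟨by positivity, ?_⟩)
          (Real.sqrt_nonneg C)
        nlinarith [Real.sq_sqrt ha, Real.sq_sqrt hb,
          mul_nonneg (Real.sqrt_nonneg a) (Real.sqrt_nonneg b)]

section Cauchy

variable {α E : Type*} [MeasurableSpace α] [NormedAddCommGroup E] {μ : Measure α} {p : ℝ≥0∞}
  {f : ℕ → α → E} {g : α → E}

lemma tendsto_eLpNorm_sub_sub (hp : 1 ≤ p) (hf : ∀ k, AEStronglyMeasurable (f k) μ)
    (hg : AEStronglyMeasurable g μ)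
    (h : Tendsto (fun k => eLpNorm (fun a => f k a - g a) p μ) atTop (𝓝 0)) :
    Tendsto (fun n : ℕ × ℕ => eLpNorm (fun a => f n.1 a - f n.2 a) p μ) atTop (𝓝 0) := by
  have hsum : Tendsto (fun n : ℕ × ℕ => eLpNorm (fun a => f n.1 a - g a) p μ
      + eLpNorm (fun a => f n.2 a - g a) p μ) atTop (𝓝 0) := by
    rw [← prod_atTop_atTop_eq]
    simpa using (h.comp tendsto_fst).add (h.comp tendsto_snd)
  refine tendsto_of_tendsto_of_tendsto_of_le_of_le tendsto_const_nhds hsum (fun _ => zero_le)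
    fun n => ?_
  simpa only [Pi.sub_def, sub_sub_sub_cancel_right] using
    eLpNorm_sub_le ((hf n.1).sub hg) ((hf n.2).sub hg) hp

lemma exists_memLp_tendsto_eLpNorm_sub [CompleteSpace E] [Fact (1 ≤ p)]
    (hf : ∀ k, MemLp (f k) p μ)
    (h : Tendsto (fun n : ℕ × ℕ => eLpNorm (fun a => f n.1 a - f n.2 a) p μ) atTop (𝓝 0)) :
    ∃ g, MemLp g p μ ∧ Tendsto (fun k => eLpNorm (fun a => f k a - g a) p μ) atTop (𝓝 0) := by
  have hcauchy : CauchySeq fun k => (hf k).toLp (f k) := by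
    rw [Lp.cauchySeq_Lp_iff_cauchySeq_eLpNorm]
    refine h.congr fun n => eLpNorm_congr_ae ?_
    filter_upwards [(hf n.1).coeFn_toLp, (hf n.2).coeFn_toLp] with a h1 h2
    rw [Pi.sub_apply, h1, h2]
  obtain ⟨g, hg⟩ := cauchySeq_tendsto_of_complete hcauchy
  refine ⟨g, Lp.memLp g, (Lp.tendsto_Lp_iff_tendsto_eLpNorm' _ g).1 hg |>.congr fun k => ?_⟩
  refine eLpNorm_congr_ae ?_
  filter_upwards [(hf k).coeFn_toLp] with a ha
  rw [Pi.sub_apply, ha]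

end Cauchy

theorem MemH1.exists_isTrace (hΩ : IsBoundedLipschitz Ω) {x : Plane → ℝ} (hx : MemH1 Ω x) :
    ∃ g, IsTrace Ω x g := by
  obtain ⟨hx2, G, hxG, hG⟩ := hx
  obtain ⟨ψ, hψ⟩ := hxG.exists_approximatesH1 hΩ hx2 hG
  obtain ⟨C, hC⟩ := exists_eLpNorm_boundary_le hΩ
  have hcauchy := tendsto_eLpNorm_sub_sub one_le_two
    (fun k => (hψ.contDiff k).continuous.aestronglyMeasurable) hx2.1 hψ.tendsto
  have hcauchy_grad := tendsto_eLpNorm_sub_sub one_le_two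
    (fun k => (continuous_gradient (hψ.contDiff k)).aestronglyMeasurable) hG.1 hψ.tendsto_grad
  have hlim := ENNReal.Tendsto.const_mul (a := (C : ℝ≥0∞)) (hcauchy.add hcauchy_grad)
    (Or.inr ENNReal.coe_ne_top)
  rw [add_zero, mul_zero] at hlim
  obtain ⟨g, hg, hψg⟩ := exists_memLp_tendsto_eLpNorm_sub
    (fun k => memLp_boundary_of_continuousOn hΩ (hψ.contDiff k).continuous.continuousOn 2)
    (tendsto_of_tendsto_of_tendsto_of_le_of_le tendsto_const_nhds hlim (fun _ => zero_le)
      fun n => by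
        have hgrad : gradient (fun z => ψ n.1 z - ψ n.2 z) =
            fun z => gradient (ψ n.1) z - gradient (ψ n.2) z :=
          funext fun z => gradient_sub ((hψ.contDiff n.1).differentiable (by simp) z)
            ((hψ.contDiff n.2).differentiable (by simp) z)
        simpa only [hgrad] using hC _ ((hψ.contDiff n.1).sub (hψ.contDiff n.2)))
  exact ⟨g, hg, G, ψ, hxG, hψ.contDiff, hψ.tendsto, hψ.tendsto_grad, hψg⟩

section L2Limits

variable {α E : Type*} [MeasurableSpace α] [NormedAddCommGroup E] {μ : Measure α}

lemma tendsto_eLpNorm_smul_sub [NormedSpace ℝ E] {p : ℝ≥0∞} {f : ℕ → α → ℝ} {f' : α → ℝ}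
    {w : α → E} (hf : ∀ k, AEStronglyMeasurable (f k) μ) (hf' : AEStronglyMeasurable f' μ)
    (hw : MemLp w ⊤ μ) (h : Tendsto (fun k => eLpNorm (fun a => f k a - f' a) p μ) atTop (𝓝 0)) :
    Tendsto (fun k => eLpNorm (fun a => f k a • w a - f' a • w a) p μ) atTop (𝓝 0) := by
  have hlim := ENNReal.Tendsto.mul_const (b := eLpNorm w ⊤ μ) h (Or.inr hw.2.ne)
  rw [zero_mul] at hlim
  refine tendsto_of_tendsto_of_tendsto_of_le_of_le tendsto_const_nhds hlim (fun _ => zero_le)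
    fun k => ?_
  simpa only [← sub_smul] using!
    eLpNorm_smul_le_eLpNorm_mul_eLpNorm_top p w ((hf k).sub hf')

variable [InnerProductSpace ℝ E]

lemma inner_toLp {f g : α → E} (hf : MemLp f 2 μ) (hg : MemLp g 2 μ) :
    inner ℝ (hf.toLp f) (hg.toLp g) = ∫ a, inner ℝ (f a) (g a) ∂μ := by
  rw [L2.inner_def]
  refine integral_congr_ae ?_
  filter_upwards [hf.coeFn_toLp, hg.coeFn_toLp] with a h1 h2
  rw [h1, h2]

lemma tendsto_integral_inner {f g : ℕ → α → E} {f' g' : α → E} (hf : ∀ k, MemLp (f k) 2 μ)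
    (hf' : MemLp f' 2 μ) (hg : ∀ k, MemLp (g k) 2 μ) (hg' : MemLp g' 2 μ)
    (hff' : Tendsto (fun k => eLpNorm (fun a => f k a - f' a) 2 μ) atTop (𝓝 0))
    (hgg' : Tendsto (fun k => eLpNorm (fun a => g k a - g' a) 2 μ) atTop (𝓝 0)) :
    Tendsto (fun k => ∫ a, inner ℝ (f k a) (g k a) ∂μ) atTop
      (𝓝 (∫ a, inner ℝ (f' a) (g' a) ∂μ)) := by
  simp only [← inner_toLp (hf _) (hg _), ← inner_toLp hf' hg']
  exact ((Lp.tendsto_Lp_iff_tendsto_eLpNorm'' _ hf _ hf').2 hff').inner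
    ((Lp.tendsto_Lp_iff_tendsto_eLpNorm'' _ hg _ hg').2 hgg')

lemma tendsto_integral_mul_inner {f : ℕ → α → ℝ} {f' : α → ℝ} {g : ℕ → α → E} {g' w : α → E}
    (hf : ∀ k, MemLp (f k) 2 μ) (hf' : MemLp f' 2 μ) (hg : ∀ k, MemLp (g k) 2 μ)
    (hg' : MemLp g' 2 μ) (hw : MemLp w ⊤ μ)
    (hff' : Tendsto (fun k => eLpNorm (fun a => f k a - f' a) 2 μ) atTop (𝓝 0))
    (hgg' : Tendsto (fun k => eLpNorm (fun a => g k a - g' a) 2 μ) atTop (𝓝 0)) :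
    Tendsto (fun k => ∫ a, f k a * inner ℝ (g k a) (w a) ∂μ) atTop
      (𝓝 (∫ a, f' a * inner ℝ (g' a) (w a) ∂μ)) := by
  simpa only [Pi.smul_apply', inner_smul_right] using tendsto_integral_inner hg hg'
    (fun k => hw.smul (hf k)) (hw.smul hf') hgg'
    (tendsto_eLpNorm_smul_sub (fun k => (hf k).1) hf'.1 hw hff')

lemma tendsto_integral_mul_mul {f g : ℕ → α → ℝ} {f' g' w : α → ℝ}
    (hf : ∀ k, MemLp (f k) 2 μ) (hf' : MemLp f' 2 μ) (hg : ∀ k, MemLp (g k) 2 μ)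
    (hg' : MemLp g' 2 μ) (hw : MemLp w ⊤ μ)
    (hff' : Tendsto (fun k => eLpNorm (fun a => f k a - f' a) 2 μ) atTop (𝓝 0))
    (hgg' : Tendsto (fun k => eLpNorm (fun a => g k a - g' a) 2 μ) atTop (𝓝 0)) :
    Tendsto (fun k => ∫ a, f k a * g k a * w a ∂μ) atTop (𝓝 (∫ a, f' a * g' a * w a ∂μ)) := by
  simpa only [Real.inner_apply, mul_assoc] using
    tendsto_integral_mul_inner hf hf' hg hg' hw hff' hgg'

lemma memLp_two_inner {f w : α → E} (hf : MemLp f 2 μ) (hw : MemLp w ⊤ μ) :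
    MemLp (fun a => inner ℝ (f a) (w a)) 2 μ :=
  (innerSL ℝ).memLp_of_bilin 2 hf hw

lemma integrable_mul_inner {f : α → ℝ} {g w : α → E} (hf : MemLp f 2 μ) (hg : MemLp g 2 μ)
    (hw : MemLp w ⊤ μ) : Integrable (fun a => f a * inner ℝ (g a) (w a)) μ :=
  hf.integrable_mul (memLp_two_inner hg hw)

lemma integrable_mul_mul {f g w : α → ℝ} (hf : MemLp f 2 μ) (hg : MemLp g 2 μ)
    (hw : MemLp w ⊤ μ) : Integrable (fun a => f a * g a * w a) μ := by
  simpa only [Real.inner_apply, mul_assoc] using integrable_mul_inner hf hg hw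

end L2Limits

/-- The pointwise divergence of a Lipschitz field `c`, defined almost everywhere; it represents the
weak divergence. -/
def fieldDiv (c : Plane → Plane) (z : Plane) : ℝ :=
  ∑ i, lineDeriv ℝ (fun p => c p i) z (EuclideanSpace.single i 1)

lemma isFiniteMeasure_restrict {α : Type*} [MeasurableSpace α] [PseudoMetricSpace α]
    [ProperSpace α] {μ : Measure α} [IsFiniteMeasureOnCompacts μ] {s : Set α}
    (hs : Bornology.IsBounded s) : IsFiniteMeasure (μ.restrict s) :=
  ⟨by simpa using hs.measure_lt_top⟩

section LipschitzField

variable {c : Plane → Plane} {K : ℝ≥0}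

lemma lipschitzWith_apply (hc : LipschitzWith K c) (i : Fin 2) : LipschitzWith K fun p => c p i :=
  LipschitzWith.of_dist_le_mul fun p q => by
    refine le_trans ?_ (hc.dist_le_mul p q)
    rw [dist_eq_norm, dist_eq_norm]
    exact PiLp.norm_apply_le (c p - c q) i

lemma memLp_top_fieldDiv (hc : LipschitzWith K c) (μ : Measure Plane) : MemLp (fieldDiv c) ⊤ μ :=
  memLp_finsetSum _ fun i _ => (lipschitzWith_apply hc i).memLp_lineDeriv _

lemma sum_apply_smul_single (v : Plane) : ∑ i, v i • EuclideanSpace.single i (1 : ℝ) = v := by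
  simpa using (EuclideanSpace.basisFun (Fin 2) ℝ).sum_repr v

theorem integral_fderiv_add_mul_fieldDiv (hΩ : IsBoundedLipschitz Ω) (hc : LipschitzWith K c)
    {ψ : Plane → ℝ} (hψ : ContDiff ℝ ∞ ψ) :
    ∫ z in Ω, (fderiv ℝ ψ z (c z) + ψ z * fieldDiv c z) =
      ∫ z, ψ z * normalFlux Ω c z ∂(boundaryMeasure Ω) := by
  let e (i : Fin 2) : Plane := EuclideanSpace.single i 1
  have hfin : IsFiniteMeasure (volume.restrict Ω) := isFiniteMeasure_restrict hΩ.isBounded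
  have hci (i : Fin 2) := lipschitzWith_apply hc i
  have hfderiv (z : Plane) : fderiv ℝ ψ z (c z) = ∑ i, fderiv ℝ ψ z (e i) * c z i := by
    conv_lhs => rw [← sum_apply_smul_single (c z), map_sum]
    simp only [map_smul, smul_eq_mul, mul_comm, e]
  have hflux (z : Plane) :
      normalFlux Ω c z = ∑ i, c z i * inner ℝ (e i) (outerNormal Ω z) := by
    conv_lhs => rw [normalFlux, ← sum_apply_smul_single (c z), sum_inner]
    simp only [real_inner_smul_left, e]
  have hint (i : Fin 2) : IntegrableOn
      (fun z => fderiv ℝ ψ z (e i) * c z i + ψ z * lineDeriv ℝ (fun p => c p i) z (e i)) Ω :=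
    ((memLp_restrict_of_continuous hΩ.isBounded (((hψ.continuous_fderiv (by simp)).clm_apply
        continuous_const).mul (hci i).continuous) 1).integrable le_rfl).add
      ((memLp_restrict_of_continuous hΩ.isBounded hψ.continuous ⊤).integrable_mul (q := 1)
        (((hci i).memLp_lineDeriv (e i)).mono_exponent le_top))
  have hint_boundary (i : Fin 2) : Integrable
      (fun z => ψ z * c z i * inner ℝ (e i) (outerNormal Ω z)) (boundaryMeasure Ω) :=
    integrable_mul_inner_outerNormal hΩ (hψ.continuous.mul (hci i).continuous) (e i)
  calc ∫ z in Ω, (fderiv ℝ ψ z (c z) + ψ z * fieldDiv c z)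
      = ∫ z in Ω, ∑ i, (fderiv ℝ ψ z (e i) * c z i
          + ψ z * lineDeriv ℝ (fun p => c p i) z (e i)) := by
        simp only [hfderiv, fieldDiv, Finset.mul_sum, Finset.sum_add_distrib, e]
    _ = ∑ i, ∫ z, ψ z * c z i * inner ℝ (e i) (outerNormal Ω z) ∂(boundaryMeasure Ω) := by
        rw [integral_finsetSum _ fun i _ => hint i]
        exact Finset.sum_congr rfl fun i _ => integral_mul_boundary hΩ hψ (hci i) (e i)
    _ = ∫ z, ψ z * normalFlux Ω c z ∂(boundaryMeasure Ω) := by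
        rw [← integral_finsetSum _ fun i _ => hint_boundary i]
        simp only [hflux, Finset.mul_sum, mul_assoc]

lemma integral_mul_inner_gradient_add (hΩ : IsBoundedLipschitz Ω) (hc : LipschitzWith K c)
    {ψ φ : Plane → ℝ} (hψ : ContDiff ℝ ∞ ψ) (hφ : ContDiff ℝ ∞ φ) :
    (∫ z in Ω, ψ z * inner ℝ (gradient φ z) (c z)) + (∫ z in Ω, φ z * inner ℝ (gradient ψ z) (c z))
        + ∫ z in Ω, ψ z * φ z * fieldDiv c z =
      ∫ z, ψ z * φ z * normalFlux Ω c z ∂(boundaryMeasure Ω) := by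
  have hψ2 := memLp_restrict_of_continuous hΩ.isBounded hψ.continuous 2
  have hφ2 := memLp_restrict_of_continuous hΩ.isBounded hφ.continuous 2
  have hψ' := memLp_restrict_of_continuous hΩ.isBounded (continuous_gradient hψ) 2
  have hφ' := memLp_restrict_of_continuous hΩ.isBounded (continuous_gradient hφ) 2
  have hc_top := memLp_restrict_of_continuous hΩ.isBounded hc.continuous ⊤
  have hψφ := integrable_mul_inner hψ2 hφ' hc_top
  have hφψ := integrable_mul_inner hφ2 hψ' hc_top
  rw [← integral_fderiv_add_mul_fieldDiv hΩ hc (hψ.mul hφ), ← integral_add hψφ hφψ,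
    ← integral_add (hψφ.fun_add hφψ) (integrable_mul_mul hψ2 hφ2 (memLp_top_fieldDiv hc _))]
  congr 1 with z
  rw [fderiv_fun_mul (hψ.differentiable (by simp) z) (hφ.differentiable (by simp) z)]
  simp [inner_gradient_left]

end LipschitzField

/-- A sequence `ψ` of functions that are smooth up to the boundary converges in `H¹(Ω)` to the
function `x` with weak gradient `G`, and its boundary values converge in `L²(Γ)` to `g`. -/
structure ApproximatesTrace (Ω : Set Plane) (ψ : ℕ → Plane → ℝ) (x : Plane → ℝ)
    (G : Plane → Plane) (g : Plane → ℝ) : Prop extends ApproximatesH1 Ω ψ x G where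
  memLp_trace : MemLp g 2 (boundaryMeasure Ω)
  tendsto_trace :
    Tendsto (fun k => eLpNorm (fun z => ψ k z - g z) 2 (boundaryMeasure Ω)) atTop (𝓝 0)

section ApproximatesTrace

variable {c : Plane → Plane} {K : ℝ≥0} {ψ φ : ℕ → Plane → ℝ} {x y : Plane → ℝ}
  {G H : Plane → Plane} {g h : Plane → ℝ}

lemma approximatesTrace_of_contDiff (hΩ : IsBoundedLipschitz Ω) {θ : Plane → ℝ}
    (hθ : ContDiff ℝ ∞ θ) : ApproximatesTrace Ω (fun _ => θ) θ (gradient θ) θ where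
  memLp := memLp_restrict_of_continuous hΩ.isBounded hθ.continuous 2
  memLp_grad := memLp_restrict_of_continuous hΩ.isBounded (continuous_gradient hθ) 2
  contDiff _ := hθ
  tendsto := by simp
  tendsto_grad := by simp
  memLp_trace := memLp_boundary_of_continuousOn hΩ hθ.continuous.continuousOn 2
  tendsto_trace := by simp

theorem ApproximatesTrace.integral_mul_inner_add (hΩ : IsBoundedLipschitz Ω)
    (hc : LipschitzWith K c) (hx : ApproximatesTrace Ω ψ x G g)
    (hy : ApproximatesTrace Ω φ y H h) :
    (∫ z in Ω, x z * inner ℝ (H z) (c z)) + (∫ z in Ω, y z * inner ℝ (G z) (c z))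
        + ∫ z in Ω, x z * y z * fieldDiv c z =
      ∫ z, g z * h z * normalFlux Ω c z ∂(boundaryMeasure Ω) := by
  have hψ2 (k) := memLp_restrict_of_continuous hΩ.isBounded (hx.contDiff k).continuous 2
  have hφ2 (k) := memLp_restrict_of_continuous hΩ.isBounded (hy.contDiff k).continuous 2
  have hψ' (k) :=
    memLp_restrict_of_continuous hΩ.isBounded (continuous_gradient (hx.contDiff k)) 2
  have hφ' (k) :=
    memLp_restrict_of_continuous hΩ.isBounded (continuous_gradient (hy.contDiff k)) 2
  have hψΓ (k) := memLp_boundary_of_continuousOn hΩ (hx.contDiff k).continuous.continuousOn 2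
  have hφΓ (k) := memLp_boundary_of_continuousOn hΩ (hy.contDiff k).continuous.continuousOn 2
  have hc_top := memLp_restrict_of_continuous hΩ.isBounded hc.continuous ⊤
  have hlim := ((tendsto_integral_mul_inner hψ2 hx.memLp hφ' hy.memLp_grad hc_top hx.tendsto
    hy.tendsto_grad).add (tendsto_integral_mul_inner hφ2 hy.memLp hψ' hx.memLp_grad hc_top
    hy.tendsto hx.tendsto_grad)).add (tendsto_integral_mul_mul hψ2 hx.memLp hφ2 hy.memLp
    (memLp_top_fieldDiv hc _) hx.tendsto hy.tendsto)
  have hlim_boundary := tendsto_integral_mul_mul hψΓ hx.memLp_trace hφΓ hy.memLp_trace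
    (memLp_top_normalFlux hΩ hc.continuous.continuousOn) hx.tendsto_trace hy.tendsto_trace
  refine tendsto_nhds_unique hlim (hlim_boundary.congr fun k => ?_)
  exact (integral_mul_inner_gradient_add hΩ hc (hx.contDiff k) (hy.contDiff k)).symm

lemma ApproximatesTrace.memLp_div (hΩ : IsBoundedLipschitz Ω) (hc : LipschitzWith K c)
    (hx : ApproximatesTrace Ω ψ x G g) :
    MemLp (fun z => inner ℝ (G z) (c z) + x z * fieldDiv c z) 2 (volume.restrict Ω) :=
  (memLp_two_inner hx.memLp_grad
    (memLp_restrict_of_continuous hΩ.isBounded hc.continuous ⊤)).add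
    ((memLp_top_fieldDiv hc _).mul hx.memLp)

theorem ApproximatesTrace.isWeakDiv (hΩ : IsBoundedLipschitz Ω) (hc : LipschitzWith K c)
    (hx : ApproximatesTrace Ω ψ x G g) :
    IsWeakDiv Ω (fun z => x z • c z) fun z => inner ℝ (G z) (c z) + x z * fieldDiv c z := by
  have hfin : IsFiniteMeasure (volume.restrict Ω) := isFiniteMeasure_restrict hΩ.isBounded
  have hc_top := memLp_restrict_of_continuous hΩ.isBounded hc.continuous ⊤
  have hdiv_top := memLp_top_fieldDiv hc (volume.restrict Ω)
  have hxc : IntegrableOn (fun z => x z • c z) Ω :=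
    MemLp.integrable one_le_two (hc_top.smul hx.memLp)
  have hd : IntegrableOn (fun z => inner ℝ (G z) (c z) + x z * fieldDiv c z) Ω :=
    (hx.memLp_div hΩ hc).integrable one_le_two
  refine ⟨hxc.locallyIntegrableOn, hd.locallyIntegrableOn, fun θ hθ => ?_⟩
  have hθx := approximatesTrace_of_contDiff hΩ hθ.1
  have hbalance := hx.integral_mul_inner_add hΩ hc hθx
  have hsplit : ∫ z in Ω, (inner ℝ (G z) (c z) + x z * fieldDiv c z) * θ z =
      (∫ z in Ω, θ z * inner ℝ (G z) (c z)) + ∫ z in Ω, x z * θ z * fieldDiv c z := by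
    rw [← integral_add (integrable_mul_inner hθx.memLp hx.memLp_grad hc_top)
      (integrable_mul_mul hx.memLp hθx.memLp hdiv_top)]
    congr 1 with z
    ring
  have hboundary : ∫ z, g z * θ z * normalFlux Ω c z ∂(boundaryMeasure Ω) = 0 :=
    integral_eq_zero_of_ae <| (ae_mem_frontier Ω).mono fun z hz => by
      have hθz : θ z = 0 := image_eq_zero_of_notMem_tsupport fun hz' =>
        (hΩ.isOpen.frontier_eq ▸ hz).2 (hθ.2.2 hz')
      simp only [hθz, mul_zero, zero_mul, Pi.zero_apply]
  simp only [map_smul, smul_eq_mul, ← inner_gradient_left, hsplit]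
  linarith

lemma memLp_of_tendsto_eLpNorm {α E : Type*} [MeasurableSpace α] [NormedAddCommGroup E]
    {μ : Measure α} {p : ℝ≥0∞} {f : ℕ → α → E} {f' : α → E} (hf : ∀ k, MemLp (f k) p μ)
    (hf' : AEStronglyMeasurable f' μ)
    (h : Tendsto (fun k => eLpNorm (fun a => f k a - f' a) p μ) atTop (𝓝 0)) :
    MemLp f' p μ := by
  obtain ⟨k, hk⟩ := (h.eventually_lt_const ENNReal.zero_lt_top).exists
  have hsub : MemLp (fun a => f k a - f' a) p μ := ⟨(hf k).1.sub hf', hk⟩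
  simpa only [Pi.sub_def, sub_sub_cancel] using (hf k).sub hsub

lemma IsTrace.exists_approximatesTrace (hΩ : IsBoundedLipschitz Ω) (hxg : IsTrace Ω x g)
    (hx : MemLp x 2 (volume.restrict Ω)) : ∃ ψ G, ApproximatesTrace Ω ψ x G g := by
  obtain ⟨hg, G, ψ, hxG, hψ, hψx, hψG, hψg⟩ := hxg
  have hG := memLp_of_tendsto_eLpNorm
    (fun k => memLp_restrict_of_continuous hΩ.isBounded (continuous_gradient (hψ k)) 2)
    hxG.2.1.aestronglyMeasurable hψG
  exact ⟨ψ, G, ⟨hx, hG, hψ, hψx, hψG⟩, hg, hψg⟩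

end ApproximatesTrace

section WeakDivergence

lemma integrable_mul_of_tsupport_subset {X : Type*} [TopologicalSpace X] [MeasurableSpace X]
    [OpensMeasurableSpace X] {μ : Measure X} {s : Set X} {f θ : X → ℝ}
    (hf : LocallyIntegrableOn f s μ) (hθ : Continuous θ) (hθc : HasCompactSupport θ)
    (hθs : tsupport θ ⊆ s) : Integrable (fun z => f z * θ z) μ := by
  obtain ⟨C, hC⟩ := hθc.exists_bound_of_continuous hθ
  refine (integrableOn_iff_integrable_of_support_subset fun z hz =>
    subset_tsupport θ (right_ne_zero_of_mul hz)).1 ?_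
  exact (hf.integrableOn_compact_subset hθs hθc).mul_bdd hθ.aestronglyMeasurable (.of_forall hC)

variable {w w' : Plane → Plane} {d d' : Plane → ℝ}

lemma IsWeakDiv.ae_eq (hΩ : IsOpen Ω) (h : IsWeakDiv Ω w d) (h' : IsWeakDiv Ω w d') :
    d =ᵐ[volume.restrict Ω] d' := by
  have hzero : ∀ᵐ z, z ∈ Ω → (d - d') z = 0 := by
    refine hΩ.ae_eq_zero_of_integral_contDiff_smul_eq_zero (h.2.1.sub h'.2.1)
      fun θ hθ hθc hθΩ => ?_
    have hint {f : Plane → ℝ} (hf : LocallyIntegrableOn f Ω) :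
        IntegrableOn (fun z => f z * θ z) Ω :=
      (integrable_mul_of_tsupport_subset hf hθ.continuous hθc hθΩ).integrableOn
    calc ∫ z, θ z • (d - d') z = ∫ z in Ω, θ z • (d - d') z :=
          (setIntegral_eq_integral_of_forall_compl_eq_zero fun z hz => by
            rw [image_eq_zero_of_notMem_tsupport fun hz' => hz (hθΩ hz'), zero_smul]).symm
      _ = ∫ z in Ω, (d z * θ z - d' z * θ z) := by
          simp only [Pi.sub_apply, smul_eq_mul, mul_sub, mul_comm]
      _ = 0 := by
          rw [integral_sub (hint h.2.1) (hint h'.2.1), sub_eq_zero, ← neg_inj,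
            ← h.2.2 θ ⟨hθ, hθc, hθΩ⟩, h'.2.2 θ ⟨hθ, hθc, hθΩ⟩]
  exact (ae_restrict_iff' hΩ.measurableSet).2
    (hzero.mono fun z hz hzΩ => sub_eq_zero.1 (hz hzΩ))

lemma isWeakDiv_congr (hΩ : MeasurableSet Ω) (hw : EqOn w w' Ω) :
    IsWeakDiv Ω w d ↔ IsWeakDiv Ω w' d := by
  have hae : w =ᵐ[volume.restrict Ω] w' := (ae_restrict_mem hΩ).mono fun z hz => hw hz
  refine and_congr ⟨.congr hae, .congr hae.symm⟩
    (and_congr_right fun _ => forall₂_congr fun θ _ => ?_)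
  rw [setIntegral_congr_fun hΩ fun z hz => by rw [hw hz]]

lemma weakDiv_congr (hΩ : MeasurableSet Ω) (hw : EqOn w w' Ω) : weakDiv Ω w = weakDiv Ω w' := by
  have hpred : IsWeakDiv Ω w = IsWeakDiv Ω w' := funext fun _ => propext (isWeakDiv_congr hΩ hw)
  unfold weakDiv
  rw [hpred]

lemma IsWeakDiv.isWeakDiv_weakDiv (h : IsWeakDiv Ω w d) : IsWeakDiv Ω w (weakDiv Ω w) := by
  have hex : ∃ d, IsWeakDiv Ω w d := ⟨d, h⟩
  rw [weakDiv, dif_pos hex]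
  exact hex.choose_spec

lemma IsWeakDiv.weakDiv_ae_eq (hΩ : IsOpen Ω) (h : IsWeakDiv Ω w d) :
    weakDiv Ω w =ᵐ[volume.restrict Ω] d :=
  h.isWeakDiv_weakDiv.ae_eq hΩ h

lemma isTrace_boundaryTrace (hΩ : IsBoundedLipschitz Ω) {x : Plane → ℝ} (hx : MemH1 Ω x) :
    IsTrace Ω x (boundaryTrace Ω x) := by
  have hex := hx.exists_isTrace hΩ
  rw [boundaryTrace, dif_pos hex]
  exact hex.choose_spec

end WeakDivergence

section FluxBalance

variable {c : Plane → Plane} {K : ℝ≥0} {x : Plane → ℝ}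

lemma isWeakDiv_fieldDiv (hΩ : IsBoundedLipschitz Ω) (hc : LipschitzWith K c) :
    IsWeakDiv Ω c (fieldDiv c) := by
  simpa [gradient] using (approximatesTrace_of_contDiff hΩ
    (contDiff_const (c := (1 : ℝ)))).isWeakDiv hΩ hc

lemma exists_isWeakDiv_memLp_top (hΩ : IsBoundedLipschitz Ω)
    (hc : LipschitzOnWith K c (closure Ω)) :
    ∃ d, IsWeakDiv Ω c d ∧ MemLp d ⊤ (volume.restrict Ω) := by
  obtain ⟨c', hc', hcc'⟩ := hc.extend_finite_dimension
  exact ⟨fieldDiv c', (isWeakDiv_congr hΩ.isOpen.measurableSet (hcc'.mono subset_closure)).2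
    (isWeakDiv_fieldDiv hΩ hc'), memLp_top_fieldDiv hc' _⟩

lemma memLp_top_weakDiv (hΩ : IsBoundedLipschitz Ω) (hc : LipschitzOnWith K c (closure Ω)) :
    MemLp (weakDiv Ω c) ⊤ (volume.restrict Ω) := by
  obtain ⟨d, hd, hd_top⟩ := exists_isWeakDiv_memLp_top hΩ hc
  exact hd_top.ae_eq (hd.weakDiv_ae_eq hΩ.isOpen).symm

lemma ApproximatesTrace.integral_mul_div (hΩ : IsBoundedLipschitz Ω) (hc : LipschitzWith K c)
    {ψ : ℕ → Plane → ℝ} {G : Plane → Plane} {g : Plane → ℝ}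
    (hx : ApproximatesTrace Ω ψ x G g) :
    ∫ z in Ω, x z * (inner ℝ (G z) (c z) + x z * fieldDiv c z) =
      1 / 2 * (∫ z in Ω, x z * x z * fieldDiv c z)
        + 1 / 2 * ∫ z, g z * g z * normalFlux Ω c z ∂(boundaryMeasure Ω) := by
  simp only [mul_add, ← mul_assoc]
  rw [integral_add (integrable_mul_inner hx.memLp hx.memLp_grad
      (memLp_restrict_of_continuous hΩ.isBounded hc.continuous ⊤))
      (integrable_mul_mul hx.memLp hx.memLp (memLp_top_fieldDiv hc _)),
    ← hx.integral_mul_inner_add hΩ hc hx]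
  ring

theorem MemH1.exists_isWeakDiv_smul (hΩ : IsBoundedLipschitz Ω)
    (hc : LipschitzOnWith K c (closure Ω)) (hx : MemH1 Ω x) :
    ∃ d, IsWeakDiv Ω (fun z => x z • c z) d ∧ MemLp d 2 (volume.restrict Ω) ∧
      ∫ z in Ω, x z * d z =
        1 / 2 * (∫ z in Ω, x z * x z * weakDiv Ω c z)
          + 1 / 2 * ∫ z, boundaryTrace Ω x z ^ 2 * normalFlux Ω c z ∂(boundaryMeasure Ω) := by
  have hΩm := hΩ.isOpen.measurableSet
  obtain ⟨c', hc', hcc'⟩ := hc.extend_finite_dimension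
  have hcc'Ω : EqOn c c' Ω := hcc'.mono subset_closure
  obtain ⟨ψ, G, hψ⟩ := (isTrace_boundaryTrace hΩ hx).exists_approximatesTrace hΩ hx.1
  refine ⟨_, (isWeakDiv_congr hΩm fun z hz => by rw [hcc'Ω hz]).2 (hψ.isWeakDiv hΩ hc'),
    hψ.memLp_div hΩ hc', ?_⟩
  have hdiv : ∫ z in Ω, x z * x z * weakDiv Ω c z = ∫ z in Ω, x z * x z * fieldDiv c' z := by
    rw [weakDiv_congr hΩm hcc'Ω]
    refine integral_congr_ae (((isWeakDiv_fieldDiv hΩ hc').weakDiv_ae_eq hΩ.isOpen).mono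
      fun z hz => ?_)
    simp only [hz]
  have hflux : ∫ z, boundaryTrace Ω x z ^ 2 * normalFlux Ω c z ∂(boundaryMeasure Ω) =
      ∫ z, boundaryTrace Ω x z * boundaryTrace Ω x z * normalFlux Ω c' z ∂(boundaryMeasure Ω) :=
    integral_congr_ae ((ae_mem_frontier Ω).mono fun z hz => by
      simp only [normalFlux, hcc' (frontier_subset_closure hz), sq])
  rw [hdiv, hflux, hψ.integral_mul_div hΩ hc']

end FluxBalance

section InputOutput

variable {c : Plane → Plane} {g u y : Plane → ℝ}

lemma integrable_sq_mul_normalFlux (hΩ : IsBoundedLipschitz Ω) (hc : ContinuousOn c (frontier Ω))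
    (hg : MemLp g 2 (boundaryMeasure Ω)) :
    Integrable (fun z => g z ^ 2 * normalFlux Ω c z) (boundaryMeasure Ω) := by
  simpa only [sq] using integrable_mul_mul hg hg (memLp_top_normalFlux hΩ hc)

lemma integrableOn_inflow (hΩ : IsBoundedLipschitz Ω) (hc : ContinuousOn c (frontier Ω))
    (hg : MemLp g 2 (boundaryMeasure Ω))
    (hu : u =ᵐ[(boundaryMeasure Ω).restrict (inflow Ω c)] g) :
    IntegrableOn (fun z => u z ^ 2 * |normalFlux Ω c z|) (inflow Ω c) (boundaryMeasure Ω) := by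
  refine (integrable_sq_mul_normalFlux hΩ hc hg).abs.integrableOn.congr (hu.mono fun z hz => ?_)
  simp only [abs_mul, abs_sq, hz]

lemma integrableOn_outflow (hΩ : IsBoundedLipschitz Ω) (hc : ContinuousOn c (frontier Ω))
    (hg : MemLp g 2 (boundaryMeasure Ω))
    (hy : y =ᵐ[(boundaryMeasure Ω).restrict (outflow Ω c)] g) :
    IntegrableOn (fun z => y z ^ 2 * normalFlux Ω c z) (outflow Ω c) (boundaryMeasure Ω) :=
  (integrable_sq_mul_normalFlux hΩ hc hg).integrableOn.congr (hy.mono fun z hz => by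
    simp only [hz])

lemma integral_mul_eq_setIntegral_pos_sub_neg {α : Type*} [MeasurableSpace α] {μ : Measure α}
    {f q : α → ℝ} (hq : AEMeasurable q μ) (hfq : Integrable (fun a => f a * q a) μ) :
    ∫ a, f a * q a ∂μ =
      (∫ a in {a | 0 < q a}, f a * q a ∂μ) - ∫ a in {a | q a < 0}, f a * |q a| ∂μ := by
  have hneg : NullMeasurableSet {a | q a < 0} μ := nullMeasurableSet_lt hq aemeasurable_const
  have habs : ∫ a in {a | q a < 0}, f a * |q a| ∂μ = -∫ a in {a | q a < 0}, f a * q a ∂μ := by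
    rw [← integral_neg]
    exact integral_congr_ae ((ae_restrict_mem₀ hneg).mono fun a (ha : q a < 0) => by
      simp only [abs_of_neg ha, mul_neg])
  have hdisj : Disjoint {a | 0 < q a} {a | q a < 0} :=
    disjoint_left.2 fun a (hpos : 0 < q a) hneg => lt_asymm hpos hneg
  rw [habs, sub_neg_eq_add, ← setIntegral_union₀ hdisj.aedisjoint hneg hfq.integrableOn
    hfq.integrableOn]
  refine (setIntegral_eq_integral_of_forall_compl_eq_zero fun a ha => ?_).symm
  have hqa : q a = 0 := le_antisymm (not_lt.1 fun h => ha (.inl h)) (not_lt.1 fun h => ha (.inr h))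
  rw [hqa, mul_zero]

lemma integral_boundary_eq_outflow_sub_inflow (hΩ : IsBoundedLipschitz Ω)
    (hc : ContinuousOn c (frontier Ω)) (hg : MemLp g 2 (boundaryMeasure Ω))
    (hu : u =ᵐ[(boundaryMeasure Ω).restrict (inflow Ω c)] g)
    (hy : y =ᵐ[(boundaryMeasure Ω).restrict (outflow Ω c)] g) :
    ∫ z, g z ^ 2 * normalFlux Ω c z ∂(boundaryMeasure Ω) =
      (∫ z in outflow Ω c, y z ^ 2 * normalFlux Ω c z ∂(boundaryMeasure Ω))
        - ∫ z in inflow Ω c, u z ^ 2 * |normalFlux Ω c z| ∂(boundaryMeasure Ω) := by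
  have hfrontier : frontier Ω =ᵐ[boundaryMeasure Ω] univ :=
    eventuallyEq_univ.2 (ae_mem_frontier Ω)
  have hout : {z | 0 < normalFlux Ω c z} =ᵐ[boundaryMeasure Ω] outflow Ω c := by
    simpa only [univ_inter] using! (hfrontier.inter (ae_eq_refl {z | 0 < normalFlux Ω c z})).symm
  have hin : {z | normalFlux Ω c z < 0} =ᵐ[boundaryMeasure Ω] inflow Ω c := by
    simpa only [univ_inter] using! (hfrontier.inter (ae_eq_refl {z | normalFlux Ω c z < 0})).symm
  rw [integral_mul_eq_setIntegral_pos_sub_neg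
      (memLp_top_normalFlux hΩ hc).1.aemeasurable (integrable_sq_mul_normalFlux hΩ hc hg),
    setIntegral_congr_set hout, setIntegral_congr_set hin]
  congr 1
  · exact integral_congr_ae (hy.mono fun z hz => by simp only [hz])
  · exact integral_congr_ae (hu.mono fun z hz => by simp only [hz])

end InputOutput

section Approximation

variable {N : ℕ} {Φ : Fin N → Plane → ℝ} {φ φ' w : Plane → ℝ} {G G' : Plane → Plane}

lemma IsWeakGrad.add (h : IsWeakGrad Ω φ G) (h' : IsWeakGrad Ω φ' G') :
    IsWeakGrad Ω (φ + φ') (G + G') := by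
  refine ⟨h.1.add h'.1, h.2.1.add h'.2.1, fun θ hθ v => ?_⟩
  have hint {f : Plane → ℝ} (hf : LocallyIntegrableOn f Ω) :
      IntegrableOn (fun z => f z * fderiv ℝ θ z v) Ω :=
    (integrable_mul_of_tsupport_subset hf
      ((hθ.1.continuous_fderiv (by simp)).clm_apply continuous_const) (hθ.2.1.fderiv_apply ℝ v)
      ((tsupport_fderiv_apply_subset ℝ v).trans hθ.2.2)).integrableOn
  have hinner {F : Plane → Plane} (hF : LocallyIntegrableOn F Ω) :
      LocallyIntegrableOn (fun z => inner ℝ (F z) v) Ω := fun z hz => by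
    obtain ⟨s, hs, hFs⟩ := hF z hz
    exact ⟨s, hs, hFs.integrable.inner_const v⟩
  have hint_grad {F : Plane → Plane} (hF : LocallyIntegrableOn F Ω) :
      IntegrableOn (fun z => inner ℝ (F z) v * θ z) Ω :=
    (integrable_mul_of_tsupport_subset (hinner hF) hθ.1.continuous hθ.2.1 hθ.2.2).integrableOn
  simp only [Pi.add_apply, add_mul, inner_add_left]
  rw [integral_add (hint h.1) (hint h'.1), integral_add (hint_grad h.2.1) (hint_grad h'.2.1),
    h.2.2 θ hθ v, h'.2.2 θ hθ v, neg_add]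

lemma IsWeakGrad.const_mul (h : IsWeakGrad Ω φ G) (a : ℝ) :
    IsWeakGrad Ω (fun z => a * φ z) (fun z => a • G z) := by
  refine ⟨fun z hz => (h.1 z hz).smul a, fun z hz => (h.2.1 z hz).smul a, fun θ hθ v => ?_⟩
  simp only [inner_smul_left, RCLike.conj_to_real, mul_assoc, integral_const_mul, h.2.2 θ hθ v,
    mul_neg]

lemma memH1_zero : MemH1 Ω 0 :=
  ⟨.zero, 0, ⟨locallyIntegrableOn_zero, locallyIntegrableOn_zero, by simp⟩, .zero⟩

lemma MemH1.add (hφ : MemH1 Ω φ) (hφ' : MemH1 Ω φ') : MemH1 Ω (φ + φ') := by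
  obtain ⟨hφ2, G, hG, hG2⟩ := hφ
  obtain ⟨hφ'2, G', hG', hG'2⟩ := hφ'
  exact ⟨hφ2.add hφ'2, G + G', hG.add hG', hG2.add hG'2⟩

lemma MemH1.const_mul (hφ : MemH1 Ω φ) (a : ℝ) : MemH1 Ω (fun z => a * φ z) := by
  obtain ⟨hφ2, G, hG, hG2⟩ := hφ
  exact ⟨hφ2.const_mul a, _, hG.const_mul a, hG2.const_smul a⟩

lemma approx_eq_sum (Φ : Fin N → Plane → ℝ) (a : Fin N → ℝ) :
    approx Φ a = ∑ i, fun z => a i * Φ i z := by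
  ext z
  simp only [approx, Finset.sum_apply, mul_comm]

lemma MemH1.approx (hΦ : ∀ i, MemH1 Ω (Φ i)) (a : Fin N → ℝ) : MemH1 Ω (approx Φ a) := by
  rw [approx_eq_sum]
  exact Finset.sum_induction _ (MemH1 Ω) (fun _ _ => .add) memH1_zero fun i _ => (hΦ i).const_mul _

lemma memLp_approx (hΦ : ∀ i, MemLp (Φ i) 2 (volume.restrict Ω)) (a : Fin N → ℝ) :
    MemLp (approx Φ a) 2 (volume.restrict Ω) :=
  memLp_finsetSum _ fun i _ => (hΦ i).mul_const (a i)

lemma integral_approx_mul (hΦ : ∀ i, MemLp (Φ i) 2 (volume.restrict Ω)) (a : Fin N → ℝ)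
    (hw : MemLp w 2 (volume.restrict Ω)) :
    ∫ z in Ω, approx Φ a z * w z = ∑ i, a i * ∫ z in Ω, Φ i z * w z := by
  simp only [approx, Finset.sum_mul, mul_comm _ (a _), mul_assoc, ← integral_const_mul]
  exact integral_finsetSum _ fun i _ => ((hΦ i).integrable_mul hw).const_mul (a i)

lemma integral_approx_mul_mul_approx (hΦ : ∀ i, MemLp (Φ i) 2 (volume.restrict Ω))
    (hw : MemLp w ⊤ (volume.restrict Ω)) (a b : Fin N → ℝ) :
    ∫ z in Ω, approx Φ a z * w z * approx Φ b z =
      a ⬝ᵥ (Matrix.of fun i j => ∫ z in Ω, Φ i z * w z * Φ j z).mulVec b := by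
  have hw_approx : MemLp (fun z => w z * approx Φ b z) 2 (volume.restrict Ω) :=
    (memLp_approx hΦ b).mul hw
  simp only [mul_assoc]
  rw [integral_approx_mul hΦ a hw_approx, dotProduct]
  refine Finset.sum_congr rfl fun i _ => congrArg (a i * ·) ?_
  have hwi : MemLp (fun z => Φ i z * w z) 2 (volume.restrict Ω) := hw.mul (hΦ i)
  calc ∫ z in Ω, Φ i z * (w z * approx Φ b z) = ∫ z in Ω, approx Φ b z * (Φ i z * w z) := by
        simp only [← mul_assoc, mul_comm (approx Φ b _)]
    _ = ∑ j, b j * ∫ z in Ω, Φ j z * (Φ i z * w z) := integral_approx_mul hΦ b hwi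
    _ = ∑ j, (∫ z in Ω, Φ i z * (w z * Φ j z)) * b j := by
        simp only [← mul_assoc, mul_comm (b _), mul_comm (Φ _ _ * w _)]

lemma integral_approx_mul_approx (hΦ : ∀ i, MemLp (Φ i) 2 (volume.restrict Ω)) (a b : Fin N → ℝ) :
    ∫ z in Ω, approx Φ a z * approx Φ b z = a ⬝ᵥ (massMatrix Ω Φ).mulVec b := by
  simpa only [mul_one, massMatrix] using
    integral_approx_mul_mul_approx hΦ (memLp_top_const (1 : ℝ)) a b

lemma integral_approx_sq_mul_weakDiv {c : Plane → Plane}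
    (hΦ : ∀ i, MemLp (Φ i) 2 (volume.restrict Ω)) (hc : MemLp (weakDiv Ω c) ⊤ (volume.restrict Ω))
    (a : Fin N → ℝ) :
    ∫ z in Ω, approx Φ a z * approx Φ a z * weakDiv Ω c z =
      a ⬝ᵥ (divMatrix Ω c Φ).mulVec a := by
  simp only [mul_right_comm _ (approx Φ a _) (weakDiv Ω c _)]
  exact integral_approx_mul_mul_approx hΦ hc a a

lemma divMatrix_eq_zero {c : Plane → Plane} (hc : weakDiv Ω c =ᵐ[volume.restrict Ω] 0) :
    divMatrix Ω c Φ = 0 := by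
  ext i j
  refine integral_eq_zero_of_ae (hc.mono fun z hz => ?_)
  simp only [hz, Pi.zero_apply, mul_zero, zero_mul]

lemma discreteHamiltonian_eq (hΦ : ∀ i, MemLp (Φ i) 2 (volume.restrict Ω)) (a : Fin N → ℝ) :
    discreteHamiltonian Ω Φ a = 1 / 2 * (a ⬝ᵥ (massMatrix Ω Φ).mulVec a) := by
  rw [discreteHamiltonian, integral_approx_mul_approx hΦ]

lemma hasDerivWithinAt_discreteHamiltonian (hΦ : ∀ i, MemLp (Φ i) 2 (volume.restrict Ω))
    {xd : ℝ → Fin N → ℝ} {v : Fin N → ℝ} {S : Set ℝ} {t : ℝ} (hxd : HasDerivWithinAt xd v S t) :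
    HasDerivWithinAt (fun s => discreteHamiltonian Ω Φ (xd s))
      (∫ z in Ω, approx Φ (xd t) z * approx Φ v z) S t := by
  have hcoord (i : Fin N) : HasDerivWithinAt (fun s => xd s i) (v i) S t :=
    hasDerivWithinAt_pi.1 hxd i
  have hquad : HasDerivWithinAt (fun s => xd s ⬝ᵥ (massMatrix Ω Φ).mulVec (xd s))
      (v ⬝ᵥ (massMatrix Ω Φ).mulVec (xd t) + xd t ⬝ᵥ (massMatrix Ω Φ).mulVec v) S t := by
    simp only [dotProduct, Matrix.mulVec, ← Finset.sum_add_distrib]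
    exact .fun_sum fun i _ => (hcoord i).mul (.fun_sum fun j _ => (hcoord j).const_mul _)
  have hsymm : ∫ z in Ω, approx Φ v z * approx Φ (xd t) z =
      ∫ z in Ω, approx Φ (xd t) z * approx Φ v z := by simp only [mul_comm]
  simp only [discreteHamiltonian_eq hΦ]
  refine (hquad.const_mul (1 / 2)).congr_deriv ?_
  rw [← integral_approx_mul_approx hΦ, ← integral_approx_mul_approx hΦ, hsymm]
  ring

end Approximation

section EnergyBalance

variable {c : Plane → Plane} {K : ℝ≥0} {N : ℕ} {Φ : Fin N → Plane → ℝ} {xd : ℝ → Fin N → ℝ}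

lemma memLp_weakDiv_smul (hΩ : IsBoundedLipschitz Ω) (hc : LipschitzOnWith K c (closure Ω))
    {x : Plane → ℝ} (hx : MemH1 Ω x) :
    MemLp (weakDiv Ω fun z => x z • c z) 2 (volume.restrict Ω) := by
  obtain ⟨d, hd, hd2, -⟩ := hx.exists_isWeakDiv_smul hΩ hc
  exact hd2.ae_eq (hd.weakDiv_ae_eq hΩ.isOpen).symm

lemma integral_mul_weakDiv_smul (hΩ : IsBoundedLipschitz Ω)
    (hc : LipschitzOnWith K c (closure Ω)) {x : Plane → ℝ} (hx : MemH1 Ω x) :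
    ∫ z in Ω, x z * weakDiv Ω (fun p => x p • c p) z =
      1 / 2 * (∫ z in Ω, x z * x z * weakDiv Ω c z)
        + 1 / 2 * ∫ z, boundaryTrace Ω x z ^ 2 * normalFlux Ω c z ∂(boundaryMeasure Ω) := by
  obtain ⟨d, hd, -, hbalance⟩ := hx.exists_isWeakDiv_smul hΩ hc
  rw [← hbalance]
  exact integral_congr_ae ((hd.weakDiv_ae_eq hΩ.isOpen).mono fun z hz => by simp only [hz])

theorem IsGalerkinSolution.hasDerivWithinAt_discreteHamiltonian (hΩ : IsBoundedLipschitz Ω)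
    (hc : LipschitzOnWith K c (closure Ω)) (hΦ : ∀ i, MemH1 Ω (Φ i))
    (hxd : IsGalerkinSolution Ω c Φ xd) {t : ℝ} (ht : 0 ≤ t) :
    HasDerivWithinAt (fun s => discreteHamiltonian Ω Φ (xd s))
      (-(1 / 2) * (∫ z in Ω, approx Φ (xd t) z * approx Φ (xd t) z * weakDiv Ω c z)
        - 1 / 2 * ∫ z, boundaryTrace Ω (approx Φ (xd t)) z ^ 2 * normalFlux Ω c z
            ∂(boundaryMeasure Ω)) (Ici 0) t := by
  obtain ⟨v, hv, hgalerkin⟩ := hxd t ht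
  have hΦ2 (i : Fin N) : MemLp (Φ i) 2 (volume.restrict Ω) := (hΦ i).1
  have hx : MemH1 Ω (approx Φ (xd t)) := .approx hΦ (xd t)
  have hv2 := memLp_approx hΦ2 v
  have hdiv := memLp_weakDiv_smul hΩ hc hx
  have horth : ∫ z in Ω, approx Φ (xd t) z *
      (approx Φ v z + weakDiv Ω (fun p => approx Φ (xd t) p • c p) z) = 0 :=
    (integral_approx_mul hΦ2 (xd t) (hv2.add hdiv)).trans
      (Finset.sum_eq_zero fun i _ => mul_eq_zero_of_right _ (hgalerkin i))
  have hsplit := integral_add (hx.1.integrable_mul hv2) (hx.1.integrable_mul hdiv)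
  simp only [Pi.mul_apply, ← mul_add] at hsplit
  rw [horth, integral_mul_weakDiv_smul hΩ hc hx] at hsplit
  refine (Transport2D.hasDerivWithinAt_discreteHamiltonian hΦ2 hv).congr_deriv ?_
  linarith only [hsplit]

theorem IsGalerkinSolution.hasDerivWithinAt_discreteHamiltonian_input_output
    (hΩ : IsBoundedLipschitz Ω) (hc : LipschitzOnWith K c (closure Ω))
    (hΦ : ∀ i, MemH1 Ω (Φ i)) (hxd : IsGalerkinSolution Ω c Φ xd) {t : ℝ} (ht : 0 ≤ t)
    {u y : Plane → ℝ}
    (hu : u =ᵐ[(boundaryMeasure Ω).restrict (inflow Ω c)] boundaryTrace Ω (approx Φ (xd t)))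
    (hy : y =ᵐ[(boundaryMeasure Ω).restrict (outflow Ω c)] boundaryTrace Ω (approx Φ (xd t))) :
    HasDerivWithinAt (fun s => discreteHamiltonian Ω Φ (xd s))
      (-(1 / 2) * (xd t ⬝ᵥ (divMatrix Ω c Φ).mulVec (xd t))
        + 1 / 2 * (∫ z in inflow Ω c, u z ^ 2 * |normalFlux Ω c z| ∂(boundaryMeasure Ω))
        - 1 / 2 * ∫ z in outflow Ω c, y z ^ 2 * normalFlux Ω c z ∂(boundaryMeasure Ω))
      (Ici 0) t := by
  refine (hxd.hasDerivWithinAt_discreteHamiltonian hΩ hc hΦ ht).congr_deriv ?_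
  rw [integral_approx_sq_mul_weakDiv (fun i => (hΦ i).1) (memLp_top_weakDiv hΩ hc),
    integral_boundary_eq_outflow_sub_inflow hΩ (hc.continuousOn.mono frontier_subset_closure)
      (isTrace_boundaryTrace hΩ (.approx hΦ (xd t))).1 hu hy]
  ring

end EnergyBalance

end Transport2D

end

open Transport2D in
theorem mainTheorem2 (Ω : Set Plane) (hΩ : IsBoundedLipschitz Ω)
    (c : Plane → Plane) (hc : ∃ K : NNReal, LipschitzOnWith K c (closure Ω))
    (N : ℕ) (Φ : Fin N → Plane → ℝ) (hΦ : ∀ i, MemH1 Ω (Φ i))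
    (xd : ℝ → Fin N → ℝ) (hxd : IsGalerkinSolution Ω c Φ xd)
    (u y : ℝ → Plane → ℝ)
    (hu : ∀ t : ℝ, 0 ≤ t → u t =ᵐ[(boundaryMeasure Ω).restrict (inflow Ω c)]
      boundaryTrace Ω (approx Φ (xd t)))
    (hy : ∀ t : ℝ, 0 ≤ t → y t =ᵐ[(boundaryMeasure Ω).restrict (outflow Ω c)]
      boundaryTrace Ω (approx Φ (xd t))) :
    -- the normal, the divergences, the traces and all the integrals are genuine
    ((∀ᵐ z ∂(boundaryMeasure Ω), IsOuterNormal Ω z (outerNormal Ω z)) ∧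
      IsWeakDiv Ω c (weakDiv Ω c) ∧
      (∀ i j, IntegrableOn (fun z => Φ i z * Φ j z) Ω) ∧
      (∀ i j, IntegrableOn (fun z => Φ i z * weakDiv Ω c z * Φ j z) Ω)) ∧
    (∀ t : ℝ, 0 ≤ t →
      IsWeakDiv Ω (fun p => approx Φ (xd t) p • c p)
        (weakDiv Ω (fun p => approx Φ (xd t) p • c p)) ∧
      MemLp (weakDiv Ω (fun p => approx Φ (xd t) p • c p)) 2 (volume.restrict Ω) ∧
      IsTrace Ω (approx Φ (xd t)) (boundaryTrace Ω (approx Φ (xd t))) ∧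
      Integrable (fun z => boundaryTrace Ω (approx Φ (xd t)) z ^ 2 * normalFlux Ω c z)
        (boundaryMeasure Ω) ∧
      IntegrableOn (fun z => u t z ^ 2 * |normalFlux Ω c z|) (inflow Ω c) (boundaryMeasure Ω) ∧
      IntegrableOn (fun z => y t z ^ 2 * normalFlux Ω c z) (outflow Ω c) (boundaryMeasure Ω)) ∧
    -- the discretized Hamiltonian is a quadratic form in the coefficients
    (∀ t : ℝ, 0 ≤ t → discreteHamiltonian Ω Φ (xd t) =
      1 / 2 * (xd t ⬝ᵥ (massMatrix Ω Φ).mulVec (xd t))) ∧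
    -- the balance in terms of the approximated state
    (∀ t : ℝ, 0 ≤ t → HasDerivWithinAt (fun s => discreteHamiltonian Ω Φ (xd s))
      (-(1 / 2) * (∫ z in Ω, approx Φ (xd t) z * approx Φ (xd t) z * weakDiv Ω c z)
        - 1 / 2 * ∫ z, boundaryTrace Ω (approx Φ (xd t)) z ^ 2 * normalFlux Ω c z
            ∂(boundaryMeasure Ω)) (Set.Ici 0) t) ∧
    -- the balance in terms of the coefficients, the input and the output
    (∀ t : ℝ, 0 ≤ t → HasDerivWithinAt (fun s => discreteHamiltonian Ω Φ (xd s))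
      (-(1 / 2) * (xd t ⬝ᵥ (divMatrix Ω c Φ).mulVec (xd t))
        + 1 / 2 * (∫ z in inflow Ω c, u t z ^ 2 * |normalFlux Ω c z| ∂(boundaryMeasure Ω))
        - 1 / 2 * ∫ z in outflow Ω c, y t z ^ 2 * normalFlux Ω c z ∂(boundaryMeasure Ω))
      (Set.Ici 0) t) ∧
    -- the scattering energy preserving balance for divergence-free velocity fields
    (weakDiv Ω c =ᵐ[volume.restrict Ω] 0 →
      ∀ t : ℝ, 0 ≤ t → HasDerivWithinAt (fun s => discreteHamiltonian Ω Φ (xd s))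
        (1 / 2 * (∫ z in inflow Ω c, u t z ^ 2 * |normalFlux Ω c z| ∂(boundaryMeasure Ω))
          - 1 / 2 * ∫ z in outflow Ω c, y t z ^ 2 * normalFlux Ω c z ∂(boundaryMeasure Ω))
        (Set.Ici 0) t) := by
  obtain ⟨K, hc⟩ := hc
  have hcΓ : ContinuousOn c (frontier Ω) := hc.continuousOn.mono frontier_subset_closure
  have hΦ2 (i : Fin N) : MemLp (Φ i) 2 (volume.restrict Ω) := (hΦ i).1
  have hΦdiv (i : Fin N) : MemLp (fun z => Φ i z * weakDiv Ω c z) 2 (volume.restrict Ω) :=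
    (memLp_top_weakDiv hΩ hc).mul (hΦ2 i)
  have hx (t : ℝ) : MemH1 Ω (approx Φ (xd t)) := .approx hΦ (xd t)
  have htrace (t : ℝ) := isTrace_boundaryTrace hΩ (hx t)
  obtain ⟨d, hd, -⟩ := exists_isWeakDiv_memLp_top hΩ hc
  have hbalance (t : ℝ) (ht : 0 ≤ t) :=
    hxd.hasDerivWithinAt_discreteHamiltonian_input_output hΩ hc hΦ ht (hu t ht) (hy t ht)
  refine ⟨⟨ae_isOuterNormal hΩ, hd.isWeakDiv_weakDiv, fun i j => (hΦ2 i).integrable_mul (hΦ2 j),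
      fun i j => (hΦdiv i).integrable_mul (hΦ2 j)⟩,
    fun t ht => ⟨?_, memLp_weakDiv_smul hΩ hc (hx t), htrace t,
      integrable_sq_mul_normalFlux hΩ hcΓ (htrace t).1,
      integrableOn_inflow hΩ hcΓ (htrace t).1 (hu t ht),
      integrableOn_outflow hΩ hcΓ (htrace t).1 (hy t ht)⟩,
    fun t _ => discreteHamiltonian_eq hΦ2 (xd t),
    fun t ht => hxd.hasDerivWithinAt_discreteHamiltonian hΩ hc hΦ ht, hbalance,
    fun hdiv t ht => ?_⟩
  · obtain ⟨_, hd, -⟩ := (hx t).exists_isWeakDiv_smul hΩ hc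
    exact hd.isWeakDiv_weakDiv
  · simpa only [divMatrix_eq_zero hdiv, Matrix.zero_mulVec, dotProduct_zero, mul_zero, zero_add]
      using hbalance t ht
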